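/- Let $M$ be a smooth manifold without boundary (Hausdorff, second countable) of dimension $n$, equipped with a Borel measure $\mu$ that is finite on compact sets. Let $\mathbf X=\{X_1,\dots,X_r\}$ be a Hörmander system on $M$: smooth real vector fields such that at every $x\in M$ the values at $x$ of the real Lie algebra of vector fields generated by $X_1,\dots,X_r$ fill the tangent space $T_xM$. Let $\mathcal L=-\sum_{j=1}^r X_j^2$ be the associated sub-Laplacian. Functions are complex-valued. For a word $w=(j_1,\dots,j_k)$ in $\{1,\dots,r\}$ write $X_w=X_{j_1}\cdots X_{j_k}$ and $|w|=k$. Assume: 1. (Sobolev embedding) there are $m\in\mathbb N_0$ and $C\ge 0$ such that $\|f\|_{L^\infty(\mu)}\le C\sum_{|w|\le m}\|X_w f\|_{L^2(\mu)}$ for all $f\in C_0^\infty(M)$; 2. $\mathcal L$, with domain (the classes of) the functions in $C_0^\infty(M)$, is a well-defined, non-negative and essentially self-adjoint operator on $L^2(M,\mu)$; its self-adjoint closure is again denoted by $\mathcal L$. Let $s\ge 1$, and let $\gamma^s_{\mathbf X,L^2}(M)$ be the set of all $\varphi\in C^\infty(M)$ for which there are $A,C>0$ such that for every $\alpha\in\mathbb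 N_0^r$ and every word $w$ in which each letter $k$ occurs exactly $\alpha_k$ times, $$\|X_w\varphi\|_{L^2(\mu)}\le C\,A^{|\alpha|}(\alpha!)^s .$$ Then $$\gamma^s_{\mathbf X,L^2}(M)\subset\Big\{\varphi\in C^\infty(M)\,:\,\exists D>0\ \text{ such that }\ \|e^{D\mathcal L^{1/(2s)}}\varphi\|_{L^2}<\infty\Big\}.$$ Here the operator is given by the spectral theorem: if $E$ is the projection-valued measure on $\mathbb R$ with $\mathcal L=\int\lambda\,dE_\lambda$, the condition means that $\varphi\in L^2(M,\mu)$ and $\|e^{D\mathcal L^{1/(2s)}}\varphi\|_{L^2}^2=\int e^{2D\lambda^{1/(2s)}}\,d(E_\lambda\varphi,\varphi)<\infty$. -/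

import Mathlib

open MeasureTheory Set Filter Topology
open scoped Manifold ContDiff

noncomputable section

namespace SubGevrey

/-! ### Spectral calculus of an unbounded self-adjoint operator -/

section Spectral

variable {H : Type*} [NormedAddCommGroup H] [InnerProductSpace ℂ H] [CompleteSpace H]

/-- A projection-valued measure on the Borel sets of the real line: each Borel set is sent to an
orthogonal projection, the whole line to the identity, and the assignment is countably additive
in the strong operator topology. (The values on non-measurable sets play no role.) -/
structure PVM (H : Type*) [NormedAddCommGroup H] [InnerProductSpace ℂ H] [CompleteSpace H] where
  proj : Set ℝ → H →L[ℂ] H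
  isStarProjection : ∀ S, MeasurableSet S → IsStarProjection (proj S)
  proj_univ : proj univ = 1
  hasSum : ∀ S : ℕ → Set ℝ, (∀ i, MeasurableSet (S i)) → Pairwise (Function.onFun Disjoint S) →
    ∀ u : H, HasSum (fun i => proj (S i) u) (proj (⋃ i, S i) u)

theorem PVM.re_inner_nonneg (E : PVM H) {S : Set ℝ} (hS : MeasurableSet S) (u : H) :
    0 ≤ (inner ℂ u (E.proj S u)).re := by
  have h := E.isStarProjection S hS
  have h1 : E.proj S (E.proj S u) = E.proj S u := by
    have := congrArg (fun T : H →L[ℂ] H => T u) h.isIdempotentElem.eq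
    simpa using this
  have h2 : inner ℂ u (E.proj S u) = inner ℂ (E.proj S u) (E.proj S u) := by
    have h3 := (ContinuousLinearMap.isSelfAdjoint_iff_isSymmetric.1 h.isSelfAdjoint)
      u (E.proj S u)
    have h4 : inner ℂ (E.proj S u) (E.proj S u) = inner ℂ u (E.proj S (E.proj S u)) := h3
    rw [h4, h1]
  rw [h2]
  exact inner_self_nonneg (𝕜 := ℂ) (x := E.proj S u)

theorem PVM.proj_empty (E : PVM H) (u : H) : E.proj ∅ u = 0 := by
  have h := E.hasSum (fun _ => ∅) (fun _ => MeasurableSet.empty)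
    (fun _ _ _ => by simp [Function.onFun]) u
  exact tendsto_nhds_unique tendsto_const_nhds h.summable.tendsto_atTop_zero

/-- The scalar spectral measure `S ↦ ⟨u, E(S) u⟩`, that is `d(E_λ u, u)`. -/
def PVM.scalarMeasure (E : PVM H) (u : H) : Measure ℝ :=
  Measure.ofMeasurable (fun S _ => ENNReal.ofReal (inner ℂ u (E.proj S u)).re)
    (by simp [E.proj_empty])
    (by
      intro S hS hd
      have h1 : HasSum (fun i => (inner ℂ u (E.proj (S i) u)).re)
          (inner ℂ u (E.proj (⋃ i, S i) u)).re :=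
        (Complex.reCLM.hasSum ((innerSL ℂ u).hasSum (E.hasSum S hS hd u)))
      rw [← h1.tsum_eq]
      exact ENNReal.ofReal_tsum_of_nonneg (fun i => E.re_inner_nonneg (hS i) u) h1.summable)

theorem PVM.scalarMeasure_apply (E : PVM H) (u : H) {S : Set ℝ} (hS : MeasurableSet S) :
    E.scalarMeasure u S = ENNReal.ofReal (inner ℂ u (E.proj S u)).re :=
  Measure.ofMeasurable_apply S hS

/-- `A = ∫ t dE(t)`: the domain of `A` is `{u | ∫ t² d(E_t u, u) < ∞}`, and
`⟨u, A u⟩ = ∫ t d(E_t u, u)` for all `u` in the domain (which determines `A` by polarization). -/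
def PVM.IsSpectralResolution (E : PVM H) (A : H →ₗ.[ℂ] H) : Prop :=
  (∀ u : H, u ∈ A.domain ↔ ∫⁻ t, ENNReal.ofReal (t ^ 2) ∂(E.scalarMeasure u) < ⊤) ∧
  ∀ u : A.domain,
    inner ℂ (u : H) (A u) = ((∫ t, t ∂(E.scalarMeasure (u : H)) : ℝ) : ℂ)

/-- `u` lies in the domain of `g(A) = ∫ g dE`, where `E` is the projection-valued measure of `A`:
the quantity `‖g(A) u‖² = ∫ |g(t)|² d(E_t u, u)` is finite. The existence of `E` is part of the
assertion. -/
def MemCalculusDomain (A : H →ₗ.[ℂ] H) (g : ℝ → ℝ) (u : H) : Prop :=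
  ∃ E : PVM H, E.IsSpectralResolution A ∧
    ∫⁻ t, ENNReal.ofReal (g t ^ 2) ∂(E.scalarMeasure u) < ⊤

/-- A densely defined operator whose closure is self-adjoint. -/
def IsEssentiallySelfAdjoint (A : H →ₗ.[ℂ] H) : Prop :=
  Dense (A.domain : Set H) ∧ IsSelfAdjoint A.closure

/-- `⟨A u, u⟩ ≥ 0` on the domain of `A`. -/
def IsNonnegative (A : H →ₗ.[ℂ] H) : Prop :=
  ∀ u : A.domain, 0 ≤ (inner ℂ (A u) (u : H)).re

end Spectral

/-! ### Vector fields on a manifold -/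

section Manifold

variable {n r : ℕ} {M : Type*} [TopologicalSpace M] [ChartedSpace (EuclideanSpace ℝ (Fin n)) M]

/-- The real Lie algebra of vector fields generated by a family `X` of vector fields. -/
inductive LieGenerated (X : Fin r → (x : M) → TangentSpace (𝓡 n) x) :
    ((x : M) → TangentSpace (𝓡 n) x) → Prop
  | base (j : Fin r) : LieGenerated X (X j)
  | zero : LieGenerated X 0
  | add {V W : (x : M) → TangentSpace (𝓡 n) x} :
      LieGenerated X V → LieGenerated X W → LieGenerated X (V + W)
  | smul (c : ℝ) {V : (x : M) → TangentSpace (𝓡 n) x} :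
      LieGenerated X V → LieGenerated X (c • V)
  | bracket {V W : (x : M) → TangentSpace (𝓡 n) x} :
      LieGenerated X V → LieGenerated X W → LieGenerated X (VectorField.mlieBracket (𝓡 n) V W)

variable (n r M) in
/-- A Hörmander system: smooth real vector fields `X₁, …, X_r` such that at each point the values
of the Lie algebra they generate fill the whole tangent space. -/
structure HormanderSystem [IsManifold (𝓡 n) ∞ M] where
  field : Fin r → (x : M) → TangentSpace (𝓡 n) x
  smooth : ∀ j, ContMDiff (𝓡 n) (𝓡 n).tangent ∞
    (fun x => (⟨x, field j x⟩ : TangentBundle (𝓡 n) M))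
  spanning : ∀ (x : M) (v : TangentSpace (𝓡 n) x), ∃ V, LieGenerated field V ∧ V x = v

variable [IsManifold (𝓡 n) ∞ M]

/-- Smooth complex-valued functions on `M`. -/
def IsSmooth (n : ℕ) {M : Type*} [TopologicalSpace M] [ChartedSpace (EuclideanSpace ℝ (Fin n)) M]
    (f : M → ℂ) : Prop :=
  ContMDiff (𝓡 n) 𝓘(ℝ, ℂ) ∞ f

/-- The derivative `V f` of a complex-valued function along a vector field. -/
def lieD (V : (x : M) → TangentSpace (𝓡 n) x) (f : M → ℂ) : M → ℂ :=
  fun x => mvfderiv (𝓡 n) f x (V x)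

/-- `Y₁ Y₂ ⋯ Y_k f` for the word `Y₁, …, Y_k` in the letters `X₁, …, X_r`. -/
def wordD (X : HormanderSystem n r M) : List (Fin r) → (M → ℂ) → M → ℂ
  | [], f => f
  | j :: w, f => lieD (X.field j) (wordD X w f)

/-- The sub-Laplacian `L = -∑ X_j²` as a differential operator on functions. -/
def lap (X : HormanderSystem n r M) (f : M → ℂ) : M → ℂ :=
  fun x => -∑ j, lieD (X.field j) (lieD (X.field j) f) x

theorem IsSmooth.lieD {V : (x : M) → TangentSpace (𝓡 n) x}
    (hV : ContMDiff (𝓡 n) (𝓡 n).tangent ∞ (fun x => (⟨x, V x⟩ : TangentBundle (𝓡 n) M)))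
    {f : M → ℂ} (hf : IsSmooth n f) : IsSmooth n (lieD V f) := by
  have h1 : ContMDiff (𝓡 n).tangent 𝓘(ℝ, ℂ).tangent ∞ (tangentMap (𝓡 n) 𝓘(ℝ, ℂ) f) :=
    ContMDiff.contMDiff_tangentMap hf (by simp)
  have h2 := (contMDiff_snd_tangentBundle_modelSpace (n := ∞) ℂ 𝓘(ℝ, ℂ)).comp (h1.comp hV)
  exact h2

theorem lieD_add {V : (x : M) → TangentSpace (𝓡 n) x} {f g : M → ℂ}
    (hf : IsSmooth n f) (hg : IsSmooth n g) : lieD V (f + g) = lieD V f + lieD V g := by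
  funext x
  have := mvfderiv_add (hf.mdifferentiableAt (by simp) (x := x))
    (hg.mdifferentiableAt (by simp) (x := x))
  simp [lieD, this]

theorem lieD_smul {V : (x : M) → TangentSpace (𝓡 n) x} {f : M → ℂ} (c : ℂ)
    (hf : IsSmooth n f) : lieD V (c • f) = c • lieD V f := by
  funext x
  have h := (hf.mdifferentiableAt (by simp) (x := x)).hasMFDerivAt
  have h2 : HasMFDerivAt 𝓘(ℝ, ℂ) 𝓘(ℝ, ℂ) (fun z : ℂ => c • z) (f x)
      (c • ContinuousLinearMap.id ℝ ℂ : ℂ →L[ℝ] ℂ) :=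
    ((hasFDerivAt_id (𝕜 := ℝ) (f x)).const_smul c).hasMFDerivAt
  have h3 := (h2.comp x h).mfderiv
  have h4 : mfderiv (𝓡 n) 𝓘(ℝ, ℂ) (c • f) x = _ := h3
  simp only [lieD, mvfderiv, Pi.smul_apply]
  rw [h4]
  rfl

theorem IsSmooth.lap_add (X : HormanderSystem n r M) {f g : M → ℂ}
    (hf : IsSmooth n f) (hg : IsSmooth n g) : lap X (f + g) = lap X f + lap X g := by
  funext x
  simp only [lap, Pi.add_apply]
  rw [← neg_add, ← Finset.sum_add_distrib]
  congr 1
  refine Finset.sum_congr rfl fun j _ => ?_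
  rw [lieD_add hf hg, lieD_add (hf.lieD (X.smooth j)) (hg.lieD (X.smooth j))]
  rfl

theorem IsSmooth.lap_smul (X : HormanderSystem n r M) (c : ℂ) {f : M → ℂ}
    (hf : IsSmooth n f) : lap X (c • f) = c • lap X f := by
  funext x
  simp only [lap, Pi.smul_apply]
  rw [smul_neg, Finset.smul_sum]
  congr 1
  refine Finset.sum_congr rfl fun j _ => ?_
  rw [lieD_smul c hf, lieD_smul c (hf.lieD (X.smooth j))]
  rfl

variable [MeasurableSpace M]

/-- The set of pairs `([f], [L f])` in `L²(M, μ) × L²(M, μ)`, for `f` smooth with compact support.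
-/
def lapGraph (X : HormanderSystem n r M) (μ : Measure M) :
    Submodule ℂ (Lp ℂ 2 μ × Lp ℂ 2 μ) where
  carrier := {p | ∃ f : M → ℂ, IsSmooth n f ∧ HasCompactSupport f ∧
    p.1 =ᵐ[μ] f ∧ p.2 =ᵐ[μ] lap X f}
  add_mem' := by
    rintro p q ⟨f, hf, hfc, hf1, hf2⟩ ⟨g, hg, hgc, hg1, hg2⟩
    refine ⟨f + g, hf.add hg, hfc.add hgc, (Lp.coeFn_add _ _).trans (hf1.add hg1), ?_⟩
    rw [hf.lap_add X hg]
    exact (Lp.coeFn_add _ _).trans (hf2.add hg2)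
  zero_mem' := by
    have h0 : IsSmooth n (0 : M → ℂ) := contMDiff_const
    refine ⟨0, h0, HasCompactSupport.zero, Lp.coeFn_zero _ _ _, ?_⟩
    have : lap X (0 : M → ℂ) = 0 := by simpa using h0.lap_smul X 0
    rw [this]
    exact Lp.coeFn_zero _ _ _
  smul_mem' := by
    rintro c p ⟨f, hf, hfc, hf1, hf2⟩
    refine ⟨c • f, ?_, hfc.smul_left (f := fun _ => c), ?_, ?_⟩
    · exact ((c • ContinuousLinearMap.id ℝ ℂ : ℂ →L[ℝ] ℂ).contDiff.contMDiff).comp hf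
    · exact (Lp.coeFn_smul _ _).trans (hf1.const_smul c)
    · rw [hf.lap_smul X c]
      exact (Lp.coeFn_smul _ _).trans (hf2.const_smul c)

/-- `L` does not depend on the representative: a test function that vanishes almost everywhere is
sent to a function that vanishes almost everywhere. (Automatic if `μ` charges every non-empty open
set.) -/
def LapWellDefined (X : HormanderSystem n r M) (μ : Measure M) : Prop :=
  ∀ f : M → ℂ, IsSmooth n f → HasCompactSupport f → f =ᵐ[μ] 0 → lap X f =ᵐ[μ] 0

/-- The sub-Laplacian as an unbounded operator on `L²(M, μ)` with domain the (classes of) smooth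
functions with compact support. Only meaningful under `LapWellDefined X μ`. -/
def lapOp (X : HormanderSystem n r M) (μ : Measure M) :
    Lp ℂ 2 μ →ₗ.[ℂ] Lp ℂ 2 μ :=
  (lapGraph X μ).toLinearPMap

/-- `L`, with domain the smooth functions with compact support, is an essentially self-adjoint
operator on `L²(M, μ)`. -/
structure LapEssentiallySelfAdjoint (X : HormanderSystem n r M) (μ : Measure M) : Prop where
  wellDefined : LapWellDefined X μ
  essentiallySelfAdjoint : IsEssentiallySelfAdjoint (lapOp X μ)

/-- The Sobolev embedding: for some order `m` and constant `C`, the `L^∞` norm of every test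
function is at most `C` times the sum of the `L²` norms of its derivatives along all the words of
length at most `m`. -/
def SobolevEmbedding (X : HormanderSystem n r M) (μ : Measure M) : Prop :=
  ∃ (m : ℕ) (C : NNReal), ∀ f : M → ℂ, IsSmooth n f → HasCompactSupport f →
    eLpNorm f ⊤ μ ≤
      C * ∑ k ∈ Finset.range (m + 1), ∑ w : Fin k → Fin r, eLpNorm (wordD X (List.ofFn w) f) 2 μ

/-- The `L²` sub-Laplacian Gevrey space of order `s`: here `∂^α` stands for each product
`Y₁ ⋯ Y_{|α|}` in which the letter `X_k` occurs exactly `α_k` times, in any order. -/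
def gevreyL2 (X : HormanderSystem n r M) (μ : Measure M) (s : ℝ) : Set (M → ℂ) :=
  {φ | IsSmooth n φ ∧ ∃ A C : ℝ, 0 < A ∧ 0 < C ∧ ∀ (α : Fin r → ℕ) (w : List (Fin r)),
    (∀ k, w.count k = α k) →
    eLpNorm (wordD X w φ) 2 μ ≤
      ENNReal.ofReal (C * A ^ (∑ k, α k) * ((∏ k, (α k).factorial : ℕ) : ℝ) ^ s)}

/-- Smooth functions `φ` with `‖e^{D L^{1/(2s)}} φ‖_{L²} < ∞` for some `D > 0`, where `L` denotes
the closure of the sub-Laplacian on test functions. -/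
def expSpace (X : HormanderSystem n r M) (μ : Measure M) (s : ℝ) :
    Set (M → ℂ) :=
  {φ | IsSmooth n φ ∧ ∃ D : ℝ, 0 < D ∧ ∃ u : Lp ℂ 2 μ, u =ᵐ[μ] φ ∧
    MemCalculusDomain (lapOp X μ).closure (fun t => Real.exp (D * t ^ (1 / (2 * s)))) u}

end Manifold

end SubGevrey

end

noncomputable section

namespace SubGevrey

/-! ### The spectral theorem for a bounded self-adjoint operator -/

section BoundedSelfAdjoint

variable {H : Type*} [NormedAddCommGroup H] [InnerProductSpace ℂ H] [CompleteSpace H]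
  {R : H →L[ℂ] H} (hR : IsSelfAdjoint R)

/-! Since `α! ≤ |α|!` and `L^k φ` is, up to sign, a sum of `r^k` word derivatives of length `2k`, a
Gevrey function satisfies `‖L^k φ‖ ≤ C (r A²)^k (2k)!^s`; in particular every `L^k φ` lies in `L²`.
Essential self-adjointness puts a smooth `f` with `f, L f ∈ L²` into the domain of the closure, with
value `L f` (`LapEssentiallySelfAdjoint.closure_apply_toLp`). So the `L^k φ` are the iterates of the
closure at `φ`, and `∫ t^{2k} d(E_t φ, φ) = ‖L^k φ‖²` (`IsSelfAdjointResolvent.lintegral_pow`). Even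
moments of this factorial growth make `exp (2D t^{1/(2s)})` integrable for small `D`
(`exists_lintegral_exp_rpow_lt_top`).

The spectral resolution `E` must be constructed as well. The closure `A` is nonnegative and
self-adjoint, so `R = (1 + A)⁻¹` is bounded and self-adjoint (`exists_isSelfAdjointResolvent`).
Riesz representation of `f ↦ ⟨u, f(R) u⟩` gives scalar measures `ν_u` on the spectrum of `R`;
extending the continuous calculus isometrically to `L²(ν_u)` gives the projections `1_S(R)`; and `x
↦ 1/x - 1` transports them to the projection-valued measure of `A`
(`IsSelfAdjointResolvent.isSpectralResolution`). -/

theorem cfcHom_mul_apply (f g : C(spectrum ℝ R, ℝ)) (u : H) :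
    cfcHom hR (f * g) u = cfcHom hR f (cfcHom hR g u) := by
  rw [map_mul]; rfl

theorem cfcHom_add_apply (f g : C(spectrum ℝ R, ℝ)) (u : H) :
    cfcHom hR (f + g) u = cfcHom hR f u + cfcHom hR g u := by
  rw [map_add]; rfl

theorem cfcHom_one_apply (u : H) : cfcHom hR (1 : C(spectrum ℝ R, ℝ)) u = u := by
  rw [map_one]; rfl

theorem isSelfAdjoint_cfcHom (f : C(spectrum ℝ R, ℝ)) : IsSelfAdjoint (cfcHom hR f) :=
  (IsSelfAdjoint.all f).map (cfcHom hR)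

theorem inner_cfcHom_left (f : C(spectrum ℝ R, ℝ)) (u v : H) :
    inner ℂ (cfcHom hR f u) v = inner ℂ u (cfcHom hR f v) :=
  ContinuousLinearMap.isSelfAdjoint_iff_isSymmetric.1 (isSelfAdjoint_cfcHom hR f) u v

theorem inner_cfcHom_self (f : C(spectrum ℝ R, ℝ)) (u : H) :
    inner ℂ u (cfcHom hR f u) = ((inner ℂ u (cfcHom hR f u)).re : ℂ) := by
  rw [eq_comm, ← Complex.conj_eq_iff_re, inner_conj_symm, inner_cfcHom_left]

/-- The positive functional `f ↦ ⟨u, f(R) u⟩` on continuous functions on the spectrum. -/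
def spectralFunctional (u : H) : CompactlySupportedContinuousMap (spectrum ℝ R) ℝ →ₚ[ℝ] ℝ :=
  PositiveLinearMap.mk₀
    { toFun := fun f => (inner ℂ u (cfcHom hR f.toContinuousMap u)).re
      map_add' := fun f g => by
        have : (f + g).toContinuousMap = f.toContinuousMap + g.toContinuousMap := rfl
        rw [this, cfcHom_add_apply, inner_add_right, Complex.add_re]
      map_smul' := fun c f => by
        have : (c • f).toContinuousMap = c • f.toContinuousMap := rfl
        rw [this, map_smul]
        change (inner ℂ u ((c : ℂ) • cfcHom hR f.toContinuousMap u)).re = _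
        rw [inner_smul_right, Complex.re_ofReal_mul]
        rfl }
    (fun f hf => by
      -- Positivity: with `g = √f` the value is `‖g(R) u‖²`.
      let g : C(spectrum ℝ R, ℝ) := ⟨fun x => Real.sqrt (f x), by fun_prop⟩
      have hg : f.toContinuousMap = g * g := by
        ext x
        exact (Real.mul_self_sqrt (hf x)).symm
      change 0 ≤ (inner ℂ u (cfcHom hR f.toContinuousMap u)).re
      rw [hg, cfcHom_mul_apply, ← inner_cfcHom_left]
      exact inner_self_nonneg (𝕜 := ℂ))

/-- The measure on the spectrum with `∫ f dν = ⟨u, f(R) u⟩`. -/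
def spectralMeasure (u : H) : Measure (spectrum ℝ R) :=
  RealRMK.rieszMeasure (spectralFunctional hR u)

instance (u : H) : IsFiniteMeasure (spectralMeasure hR u) := by
  unfold spectralMeasure
  infer_instance

theorem integral_spectralMeasure (u : H) (f : C(spectrum ℝ R, ℝ)) :
    ∫ x, f x ∂(spectralMeasure hR u) = (inner ℂ u (cfcHom hR f u)).re :=
  RealRMK.integral_rieszMeasure (spectralFunctional hR u)
    (CompactlySupportedContinuousMap.continuousMapEquiv f)

theorem inner_cfcHom_eq_integral (u : H) (f : C(spectrum ℝ R, ℝ)) :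
    inner ℂ u (cfcHom hR f u) = ((∫ x, f x ∂(spectralMeasure hR u) : ℝ) : ℂ) := by
  rw [integral_spectralMeasure, ← inner_cfcHom_self]

/-- Both squares equal `⟨u, f²(R) u⟩`. This isometry is what allows the calculus to extend from
continuous functions to `L²(ν_u)`. -/
theorem norm_toLp_eq (u : H) (f : C(spectrum ℝ R, ℝ)) :
    ‖ContinuousMap.toLp (E := ℝ) 2 (spectralMeasure hR u) ℝ f‖ = ‖cfcHom hR f u‖ := by
  have h1 : ‖ContinuousMap.toLp (E := ℝ) 2 (spectralMeasure hR u) ℝ f‖ ^ 2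
      = ‖cfcHom hR f u‖ ^ 2 := by
    rw [← real_inner_self_eq_norm_sq, MeasureTheory.L2.inner_def]
    have h2 : ∀ᵐ x ∂(spectralMeasure hR u),
        inner ℝ (ContinuousMap.toLp (E := ℝ) 2 (spectralMeasure hR u) ℝ f x)
          (ContinuousMap.toLp (E := ℝ) 2 (spectralMeasure hR u) ℝ f x) = (f * f) x := by
      filter_upwards [ContinuousMap.coeFn_toLp (p := 2) (𝕜 := ℝ) (spectralMeasure hR u) f] with x hx
      rw [hx]; simp [sq]
    rw [integral_congr_ae h2, integral_spectralMeasure, cfcHom_mul_apply, ← inner_cfcHom_left,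
      ← inner_self_eq_norm_sq (𝕜 := ℂ)]
    rfl
  exact (sq_eq_sq₀ (norm_nonneg _) (norm_nonneg _)).1 h1

theorem denseRange_toLp_spectralMeasure (u : H) :
    DenseRange (ContinuousMap.toLp (E := ℝ) 2 (spectralMeasure hR u) ℝ) :=
  ContinuousMap.toLp_denseRange ℝ _ _ (by simp)

/-- The isometric extension `h ↦ h(R) u` of the continuous functional calculus to `L²(ν_u)`. -/
def spectralMap (u : H) : Lp ℝ 2 (spectralMeasure hR u) →L[ℝ] H :=
  LinearMap.extendOfNorm
    ({ toFun := fun f => cfcHom hR f u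
       map_add' := fun f g => cfcHom_add_apply hR f g u
       map_smul' := fun c f => by rw [map_smul]; rfl } : C(spectrum ℝ R, ℝ) →ₗ[ℝ] H)
    (ContinuousMap.toLp (E := ℝ) 2 (spectralMeasure hR u) ℝ).toLinearMap

theorem spectralMap_toLp (u : H) (f : C(spectrum ℝ R, ℝ)) :
    spectralMap hR u (ContinuousMap.toLp (E := ℝ) 2 (spectralMeasure hR u) ℝ f)
      = cfcHom hR f u :=
  LinearMap.extendOfNorm_eq (denseRange_toLp_spectralMeasure hR u)
    ⟨1, fun x => by
      rw [one_mul]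
      exact (norm_toLp_eq hR u x).ge⟩ f

theorem norm_spectralMap (u : H) (h : Lp ℝ 2 (spectralMeasure hR u)) :
    ‖spectralMap hR u h‖ = ‖h‖ := by
  refine (denseRange_toLp_spectralMeasure hR u).induction_on h
    (isClosed_eq (by fun_prop) (by fun_prop)) fun f => ?_
  rw [spectralMap_toLp, norm_toLp_eq]

theorem exists_tendsto_toLp (u : H) (h : Lp ℝ 2 (spectralMeasure hR u)) :
    ∃ f : ℕ → C(spectrum ℝ R, ℝ),
      Tendsto (fun n => ContinuousMap.toLp (E := ℝ) 2 (spectralMeasure hR u) ℝ (f n))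
        atTop (𝓝 h) := by
  obtain ⟨x, hx, hl⟩ := mem_closure_iff_seq_limit.1 (denseRange_toLp_spectralMeasure hR u h)
  choose f hf using hx
  exact ⟨f, by simpa only [hf] using hl⟩

/-- True for continuous `h` by multiplicativity of the calculus, and in general by density, because
multiplication by the bounded function `φ` is continuous on `L²(ν_u)`. -/
theorem cfcHom_spectralMap (u : H) (φ : C(spectrum ℝ R, ℝ))
    (h h' : Lp ℝ 2 (spectralMeasure hR u))
    (hh : h' =ᵐ[spectralMeasure hR u] fun x => φ x * h x) :
    cfcHom hR φ (spectralMap hR u h) = spectralMap hR u h' := by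
  obtain ⟨f, hf⟩ := exists_tendsto_toLp hR u h
  have h1 : Tendsto (fun n => cfcHom hR φ (spectralMap hR u
      (ContinuousMap.toLp (E := ℝ) 2 (spectralMeasure hR u) ℝ (f n)))) atTop
      (𝓝 (cfcHom hR φ (spectralMap hR u h))) :=
    ((cfcHom hR φ).continuous.tendsto _).comp (((spectralMap hR u).continuous.tendsto _).comp hf)
  have h2 : Tendsto (fun n => ContinuousMap.toLp (E := ℝ) 2 (spectralMeasure hR u) ℝ (φ * f n))
      atTop (𝓝 h') := by
    rw [tendsto_iff_norm_sub_tendsto_zero] at hf ⊢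
    refine squeeze_zero (fun _ => norm_nonneg _) (fun n => ?_)
      (by simpa using hf.const_mul ‖φ‖)
    refine Lp.norm_le_mul_norm_of_ae_le_mul ?_
    filter_upwards [ContinuousMap.coeFn_toLp (p := 2) (𝕜 := ℝ) (spectralMeasure hR u) (f n),
      ContinuousMap.coeFn_toLp (p := 2) (𝕜 := ℝ) (spectralMeasure hR u) (φ * f n), hh,
      Lp.coeFn_sub (ContinuousMap.toLp (E := ℝ) 2 (spectralMeasure hR u) ℝ (φ * f n)) h',
      Lp.coeFn_sub (ContinuousMap.toLp (E := ℝ) 2 (spectralMeasure hR u) ℝ (f n)) h]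
      with x h1 h2 h3 h4 h5
    rw [h4, h5, Pi.sub_apply, Pi.sub_apply, h1, h2, h3, ContinuousMap.mul_apply, ← mul_sub,
      norm_mul]
    exact mul_le_mul_of_nonneg_right (φ.norm_coe_le_norm x) (norm_nonneg _)
  have h3 := ((spectralMap hR u).continuous.tendsto _).comp h2
  refine tendsto_nhds_unique h1 (h3.congr fun n => ?_)
  simp only [Function.comp_apply, spectralMap_toLp, cfcHom_mul_apply]

/-- Two finite measures are compared on continuous `f`: `⟨φ(R)u, f(R)φ(R)u⟩ = ⟨u, (φfφ)(R)u⟩`. -/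
theorem spectralMeasure_cfcHom (u : H) (φ : C(spectrum ℝ R, ℝ)) :
    spectralMeasure hR (cfcHom hR φ u) =
      (spectralMeasure hR u).withDensity fun x => ENNReal.ofReal (φ x ^ 2) := by
  have hm : Measurable fun x => Real.toNNReal (φ x ^ 2) := by fun_prop
  have hfin : IsFiniteMeasure
      ((spectralMeasure hR u).withDensity fun x => ENNReal.ofReal (φ x ^ 2)) := by
    refine isFiniteMeasure_withDensity_ofReal ?_
    exact ((φ ^ 2).continuous.integrable_of_hasCompactSupport (μ := spectralMeasure hR u)
      (HasCompactSupport.of_compactSpace _)).hasFiniteIntegral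
  refine ext_of_forall_integral_eq_of_IsFiniteMeasure fun f => ?_
  have h1 := integral_spectralMeasure hR (cfcHom hR φ u) f.toContinuousMap
  have h2 : ∫ x, f x ∂((spectralMeasure hR u).withDensity fun x => ENNReal.ofReal (φ x ^ 2))
      = ∫ x, (φ * (f.toContinuousMap * φ)) x ∂(spectralMeasure hR u) := by
    change ∫ x, f x ∂((spectralMeasure hR u).withDensity
      fun x => ((Real.toNNReal (φ x ^ 2) : NNReal) : ENNReal)) = _
    rw [integral_withDensity_eq_integral_smul hm]
    refine integral_congr_ae (ae_of_all _ fun x => ?_)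
    simp only [NNReal.smul_def, Real.coe_toNNReal _ (sq_nonneg (φ x)), smul_eq_mul,
      ContinuousMap.mul_apply]
    change φ x ^ 2 * f x = φ x * (f x * φ x)
    ring
  rw [h2, integral_spectralMeasure, cfcHom_mul_apply, cfcHom_mul_apply, ← inner_cfcHom_left]
  exact h1

theorem spectralMeasure_univ (u : H) :
    spectralMeasure hR u univ = ENNReal.ofReal (‖u‖ ^ 2) := by
  have h := integral_spectralMeasure hR u 1
  simp only [ContinuousMap.one_apply, integral_const, smul_eq_mul, mul_one, cfcHom_one_apply] at h
  rw [← inner_self_eq_norm_sq (𝕜 := ℂ)]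
  change _ = ENNReal.ofReal (inner ℂ u u).re
  rw [← h, measureReal_def, ENNReal.ofReal_toReal (measure_ne_top _ _)]

end BoundedSelfAdjoint

/-! ### Spectral projections of a bounded self-adjoint operator -/

section SpectralProjections

variable {H : Type*} [NormedAddCommGroup H] [InnerProductSpace ℂ H] [CompleteSpace H]
  {R : H →L[ℂ] H} (hR : IsSelfAdjoint R)

/-- The vector `1_S(R) u`. -/
def spectralCut {S : Set (spectrum ℝ R)} (hS : MeasurableSet S) (u : H) : H :=
  spectralMap hR u (indicatorConstLp 2 hS (measure_ne_top (spectralMeasure hR u) S) (1 : ℝ))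

theorem enorm_cfcHom_sub_spectralCut {S : Set (spectrum ℝ R)} (hS : MeasurableSet S) (u : H)
    (f : C(spectrum ℝ R, ℝ)) :
    ‖cfcHom hR f u - spectralCut hR hS u‖ₑ
      = eLpNorm (⇑f - S.indicator fun _ => (1 : ℝ)) 2 (spectralMeasure hR u) := by
  rw [spectralCut, ← spectralMap_toLp, ← map_sub, ← ofReal_norm, norm_spectralMap,
    ofReal_norm, Lp.enorm_def]
  refine eLpNorm_congr_ae ?_
  refine (Lp.coeFn_sub _ _).trans (EventuallyEq.sub ?_ indicatorConstLp_coeFn)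
  exact ContinuousMap.coeFn_toLp _ f

/-- `ν` is left free so that it can be a sum of spectral measures: one sequence then approximates
`1_S` for several vectors at once. -/
theorem exists_tendsto_eLpNorm_sub_indicator (ν : Measure (spectrum ℝ R)) [IsFiniteMeasure ν]
    {S : Set (spectrum ℝ R)} (hS : MeasurableSet S) :
    ∃ f : ℕ → C(spectrum ℝ R, ℝ),
      Tendsto (fun n => eLpNorm (⇑(f n) - S.indicator fun _ => (1 : ℝ)) 2 ν) atTop (𝓝 0) := by
  have hd : DenseRange (ContinuousMap.toLp (E := ℝ) 2 ν ℝ) :=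
    ContinuousMap.toLp_denseRange ℝ _ _ (by simp)
  obtain ⟨x, hx, hl⟩ := mem_closure_iff_seq_limit.1
    (hd (indicatorConstLp 2 hS (measure_ne_top ν S) (1 : ℝ)))
  choose f hf using hx
  refine ⟨f, ?_⟩
  rw [tendsto_iff_edist_tendsto_0] at hl
  refine hl.congr fun n => ?_
  rw [← hf, edist_eq_enorm_sub, Lp.enorm_def]
  refine eLpNorm_congr_ae ?_
  refine (Lp.coeFn_sub _ _).trans (EventuallyEq.sub ?_ indicatorConstLp_coeFn)
  exact ContinuousMap.coeFn_toLp _ _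

theorem tendsto_spectralCut {S : Set (spectrum ℝ R)} (hS : MeasurableSet S)
    {ν : Measure (spectrum ℝ R)} {f : ℕ → C(spectrum ℝ R, ℝ)}
    (hf : Tendsto (fun n => eLpNorm (⇑(f n) - S.indicator fun _ => (1 : ℝ)) 2 ν) atTop (𝓝 0))
    {u : H} (hu : spectralMeasure hR u ≤ ν) :
    Tendsto (fun n => cfcHom hR (f n) u) atTop (𝓝 (spectralCut hR hS u)) := by
  rw [tendsto_iff_edist_tendsto_0]
  refine tendsto_of_tendsto_of_tendsto_of_le_of_le tendsto_const_nhds hf (fun _ => zero_le)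
    fun n => ?_
  simp only [edist_eq_enorm_sub, enorm_cfcHom_sub_spectralCut]
  exact eLpNorm_mono_measure _ hu

theorem norm_spectralCut_sq {S : Set (spectrum ℝ R)} (hS : MeasurableSet S) (u : H) :
    ‖spectralCut hR hS u‖ ^ 2 = (spectralMeasure hR u).real S := by
  rw [spectralCut, norm_spectralMap, norm_indicatorConstLp (by simp) (by simp), norm_one, one_mul,
    ← Real.rpow_natCast, ← Real.rpow_mul measureReal_nonneg]
  simp

/-- The spectral projection `1_S(R)`. -/
def spectralProj {S : Set (spectrum ℝ R)} (hS : MeasurableSet S) : H →L[ℂ] H :=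
  LinearMap.mkContinuous
    { toFun := spectralCut hR hS
      map_add' := fun u v => by
        -- The cut is defined through a measure that depends on the vector, so additivity is not
        -- formal: a common approximating sequence reduces it to linearity of each `f n (R)`.
        obtain ⟨f, hf⟩ := exists_tendsto_eLpNorm_sub_indicator
          (spectralMeasure hR u + spectralMeasure hR v + spectralMeasure hR (u + v)) hS
        have h1 := tendsto_spectralCut hR hS hf (u := u) (by
          rw [add_assoc]; exact Measure.le_add_right le_rfl)
        have h2 := tendsto_spectralCut hR hS hf (u := v)
          (Measure.le_add_right (Measure.le_add_left le_rfl))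
        have h3 := tendsto_spectralCut hR hS hf (u := u + v) (Measure.le_add_left le_rfl)
        refine tendsto_nhds_unique h3 ((h1.add h2).congr fun n => ?_)
        rw [map_add]
      map_smul' := fun c u => by
        obtain ⟨f, hf⟩ := exists_tendsto_eLpNorm_sub_indicator
          (spectralMeasure hR u + spectralMeasure hR (c • u)) hS
        have h1 := tendsto_spectralCut hR hS hf (u := u) (Measure.le_add_right le_rfl)
        have h2 := tendsto_spectralCut hR hS hf (u := c • u) (Measure.le_add_left le_rfl)
        refine tendsto_nhds_unique h2 ((h1.const_smul c).congr fun n => ?_)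
        rw [map_smul] }
    1
    (fun u => by
      rw [one_mul]
      refine abs_le_of_sq_le_sq' ?_ (norm_nonneg u) |>.2
      change ‖spectralCut hR hS u‖ ^ 2 ≤ _
      rw [norm_spectralCut_sq]
      refine ENNReal.toReal_le_of_le_ofReal (sq_nonneg _) ?_
      rw [← spectralMeasure_univ hR u]
      exact measure_mono (subset_univ _))

theorem spectralProj_apply {S : Set (spectrum ℝ R)} (hS : MeasurableSet S) (u : H) :
    spectralProj hR hS u = spectralCut hR hS u := rfl

/-- Idempotence is not yet available. Instead `‖u - 1_S(R)u‖ = ‖1_{Sᶜ}(R)u‖`; expanding the left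
square and inserting `‖1_S(R)u‖² = ν_u(S)` isolates the inner product. -/
theorem re_inner_spectralProj {S : Set (spectrum ℝ R)} (hS : MeasurableSet S) (u : H) :
    (inner ℂ u (spectralProj hR hS u)).re = (spectralMeasure hR u).real S := by
  have h1 : ‖u - spectralCut hR hS u‖ = ‖spectralCut hR hS.compl u‖ := by
    have h := enorm_cfcHom_sub_spectralCut hR hS u 1
    have h' := enorm_cfcHom_sub_spectralCut hR hS.compl u 0
    rw [cfcHom_one_apply] at h
    rw [map_zero, zero_apply, zero_sub, enorm_neg] at h'
    rw [← enorm_eq_iff_norm_eq, h, h']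
    refine eLpNorm_congr_norm_ae (ae_of_all _ fun x => ?_)
    by_cases hx : x ∈ S <;> simp [hx]
  have h2 := norm_sub_sq (𝕜 := ℂ) u (spectralCut hR hS u)
  rw [h1, norm_spectralCut_sq, norm_spectralCut_sq] at h2
  have h3 : ‖u‖ ^ 2 = (spectralMeasure hR u).real univ := by
    rw [measureReal_def, spectralMeasure_univ, ENNReal.toReal_ofReal (sq_nonneg _)]
  have h4 := measureReal_add_measureReal_compl (μ := spectralMeasure hR u) hS
  change _ = _ - 2 * (inner ℂ u (spectralCut hR hS u)).re + _ at h2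
  rw [spectralProj_apply]
  linarith

theorem isSelfAdjoint_spectralProj {S : Set (spectrum ℝ R)} (hS : MeasurableSet S) :
    IsSelfAdjoint (spectralProj hR hS) := by
  refine ContinuousLinearMap.isSelfAdjoint_iff_isSymmetric.2 fun u v => ?_
  obtain ⟨f, hf⟩ := exists_tendsto_eLpNorm_sub_indicator
    (spectralMeasure hR u + spectralMeasure hR v) hS
  have h1 := tendsto_spectralCut hR hS hf (u := u) (Measure.le_add_right le_rfl)
  have h2 := tendsto_spectralCut hR hS hf (u := v) (Measure.le_add_left le_rfl)
  have h3 := (h1.inner (𝕜 := ℂ) (tendsto_const_nhds (x := v)))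
  have h4 := ((tendsto_const_nhds (x := u)).inner (𝕜 := ℂ) h2)
  exact tendsto_nhds_unique h3 (h4.congr fun n => (inner_cfcHom_left hR (f n) u v).symm)

/-- `P² - P` has zero quadratic form, as `⟨P²u, u⟩ = ‖Pu‖² = ν_u(S) = ⟨u, Pu⟩`; on a complex space
this forces `P² = P`. -/
theorem isStarProjection_spectralProj {S : Set (spectrum ℝ R)} (hS : MeasurableSet S) :
    IsStarProjection (spectralProj hR hS) := by
  have hsa := isSelfAdjoint_spectralProj hR hS
  have hsym := ContinuousLinearMap.isSelfAdjoint_iff_isSymmetric.1 hsa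
  refine ⟨?_, hsa⟩
  set P := spectralProj hR hS
  have hT : IsSelfAdjoint (P * P - P) := by
    refine IsSelfAdjoint.sub ?_ hsa
    simpa [hsa.star_eq] using IsSelfAdjoint.star_mul_self P
  have h0 : P * P - P = 0 := by
    have h1 : ((P * P - P : H →L[ℂ] H) : H →ₗ[ℂ] H) = 0 := by
      refine (inner_map_self_eq_zero _).1 fun u => ?_
      have h2 : (inner ℂ ((P * P - P) u) u : ℂ) = ((inner ℂ ((P * P - P) u) u).re : ℂ) := by
        rw [eq_comm, ← Complex.conj_eq_iff_re, inner_conj_symm]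
        exact (ContinuousLinearMap.isSelfAdjoint_iff_isSymmetric.1 hT u u).symm
      change (inner ℂ ((P * P - P) u) u : ℂ) = 0
      rw [h2, Complex.ofReal_eq_zero]
      have h3 : (P * P - P) u = P (P u) - P u := rfl
      rw [h3, inner_sub_left, Complex.sub_re]
      have h4 : inner ℂ (P (P u)) u = inner ℂ (P u) (P u) := hsym (P u) u
      have h5 : inner ℂ (P u) u = inner ℂ u (P u) := hsym u u
      rw [h4, h5, re_inner_spectralProj hR hS u, ← norm_spectralCut_sq hR hS,
        ← inner_self_eq_norm_sq (𝕜 := ℂ)]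
      exact sub_self _
    ext u
    exact congrArg (fun T : H →ₗ[ℂ] H => T u) h1
  exact sub_eq_zero.1 h0

/-- The squared `L²` distance from a finite partial sum to the limit is the mass of the remaining
sets, so countable additivity of `ν` gives norm convergence. -/
theorem hasSum_indicatorConstLp_iUnion {α : Type*} [MeasurableSpace α] (ν : Measure α)
    [IsFiniteMeasure ν] {S : ℕ → Set α} (hS : ∀ i, MeasurableSet (S i))
    (hd : Pairwise (Function.onFun Disjoint S)) :
    HasSum (fun i => indicatorConstLp 2 (hS i) (measure_ne_top ν (S i)) (1 : ℝ))
      (indicatorConstLp 2 (MeasurableSet.iUnion hS) (measure_ne_top ν (⋃ i, S i)) (1 : ℝ)) := by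
  classical
  have hsum : HasSum (fun i => ν.real (S i)) (ν.real (⋃ i, S i)) := by
    rw [measureReal_def, measure_iUnion hd hS, ENNReal.tsum_toReal_eq fun i => measure_ne_top ν (S i)]
    exact ENNReal.hasSum_toReal (by rw [← measure_iUnion hd hS]; exact measure_ne_top ν _)
  have key : ∀ F : Finset ℕ,
      ‖∑ i ∈ F, indicatorConstLp 2 (hS i) (measure_ne_top ν (S i)) (1 : ℝ)
        - indicatorConstLp 2 (MeasurableSet.iUnion hS) (measure_ne_top ν (⋃ i, S i)) (1 : ℝ)‖ ^ 2
      = ν.real (⋃ i, S i) - ∑ i ∈ F, ν.real (S i) := by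
    intro F
    have hU : MeasurableSet (⋃ i ∈ F, S i) := F.measurableSet_biUnion fun i _ => hS i
    have h1 : ∑ i ∈ F, indicatorConstLp 2 (hS i) (measure_ne_top ν (S i)) (1 : ℝ)
        = indicatorConstLp 2 hU (measure_ne_top ν _) (1 : ℝ) := by
      clear hsum
      induction F using Finset.induction_on with
      | empty =>
        simp only [Finset.sum_empty]
        refine Lp.ext ?_
        filter_upwards [Lp.coeFn_zero ℝ 2 ν, indicatorConstLp_coeFn (p := 2) (hs := hU)
          (hμs := measure_ne_top ν _) (c := (1 : ℝ))] with x h1 h2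
        rw [h1, h2]; simp
      | insert a F ha ih =>
        have hU' : MeasurableSet (⋃ i ∈ F, S i) := F.measurableSet_biUnion fun i _ => hS i
        have hdis : Disjoint (S a) (⋃ i ∈ F, S i) := by
          rw [disjoint_iUnion₂_right]
          exact fun i hi => hd (fun h => ha (h ▸ hi))
        rw [Finset.sum_insert ha, ih hU', ← indicatorConstLp_disjoint_union (hS a) hU'
          (measure_ne_top ν _) (measure_ne_top ν _) hdis]
        congr 1
        simp
    have hsub : (⋃ i ∈ F, S i) ⊆ ⋃ i, S i := iUnion₂_subset fun i _ => subset_iUnion S i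
    have h2 : indicatorConstLp 2 (MeasurableSet.iUnion hS) (measure_ne_top ν (⋃ i, S i)) (1 : ℝ)
        = indicatorConstLp 2 hU (measure_ne_top ν _) (1 : ℝ)
          + indicatorConstLp 2 ((MeasurableSet.iUnion hS).diff hU) (measure_ne_top ν _) (1 : ℝ) := by
      rw [← indicatorConstLp_disjoint_union hU _ _ _ disjoint_sdiff_right]
      congr 1
      exact (union_sdiff_cancel hsub).symm
    rw [h1, h2, sub_add_cancel_left, norm_neg, norm_indicatorConstLp (by simp) (by simp), norm_one,
      one_mul, ← Real.rpow_natCast, ← Real.rpow_mul measureReal_nonneg]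
    simp only [ENNReal.toReal_ofNat, Nat.cast_ofNat, one_div, ne_eq, OfNat.ofNat_ne_zero,
      not_false_eq_true, inv_mul_cancel₀, Real.rpow_one]
    rw [measureReal_sdiff hsub hU, measureReal_biUnion_finset (fun i _ j _ hij => hd hij)
      fun i _ => hS i]
  rw [HasSum, tendsto_iff_norm_sub_tendsto_zero]
  have h3 : Tendsto (fun F : Finset ℕ => Real.sqrt (ν.real (⋃ i, S i) - ∑ i ∈ F, ν.real (S i)))
      (SummationFilter.unconditional ℕ).filter (𝓝 0) := by
    have h4 := (Real.continuous_sqrt.tendsto _).comp (tendsto_const_nhds.sub hsum)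
      (f := fun F : Finset ℕ => ν.real (⋃ i, S i) - ∑ i ∈ F, ν.real (S i))
    simpa [Function.comp_def] using h4
  refine h3.congr fun F => ?_
  rw [← key F, Real.sqrt_sq (norm_nonneg _)]

open scoped Classical in
/-- The projection-valued measure of `g(R)`, for a Borel function `g` on the spectrum of `R`. -/
def pvmOfBounded {g : spectrum ℝ R → ℝ} (hg : Measurable g) : PVM H where
  proj S := if hS : MeasurableSet S then spectralProj hR (hg hS) else 0
  isStarProjection S hS := by
    rw [dif_pos hS]
    exact isStarProjection_spectralProj hR (hg hS)
  proj_univ := by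
    rw [dif_pos MeasurableSet.univ]
    ext u
    have h := enorm_cfcHom_sub_spectralCut hR (hg MeasurableSet.univ) u 1
    rw [cfcHom_one_apply] at h
    have h0 : (⇑(1 : C(spectrum ℝ R, ℝ)) - (g ⁻¹' univ).indicator fun _ => (1 : ℝ)) = 0 := by
      ext x
      simp
    rw [h0, eLpNorm_zero, enorm_eq_zero, sub_eq_zero] at h
    exact h.symm
  hasSum S hS hd u := by
    rw [dif_pos (MeasurableSet.iUnion hS)]
    simp only [dif_pos (hS _)]
    have h := (spectralMap hR u).hasSum (hasSum_indicatorConstLp_iUnion (spectralMeasure hR u)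
      (fun i => hg (hS i)) (fun i j hij => (hd hij).preimage g))
    have e : spectralProj hR (hg (MeasurableSet.iUnion hS)) u = spectralMap hR u
        (indicatorConstLp 2 (MeasurableSet.iUnion fun i => hg (hS i))
          (measure_ne_top (spectralMeasure hR u) _) (1 : ℝ)) := by
      rw [spectralProj_apply, spectralCut]
      congr 2
      exact preimage_iUnion
    rw [e]
    exact h

theorem scalarMeasure_pvmOfBounded {g : spectrum ℝ R → ℝ} (hg : Measurable g) (u : H) :
    (pvmOfBounded hR hg).scalarMeasure u = (spectralMeasure hR u).map g := by
  ext S hS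
  rw [PVM.scalarMeasure_apply _ _ hS, Measure.map_apply hg hS]
  have : (pvmOfBounded hR hg).proj S = spectralProj hR (hg hS) := dif_pos hS
  rw [this, re_inner_spectralProj, ofReal_measureReal]

end SpectralProjections

/-! ### The spectral theorem for an unbounded operator with a bounded self-adjoint resolvent -/

section Resolvent

variable {H : Type*} [NormedAddCommGroup H] [InnerProductSpace ℂ H] [CompleteSpace H]

/-- `R = (1 + A)⁻¹` is a bounded self-adjoint operator. -/
structure IsSelfAdjointResolvent (A : H →ₗ.[ℂ] H) (R : H →L[ℂ] H) : Prop where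
  isSelfAdjoint : IsSelfAdjoint R
  left_inv : ∀ u : A.domain, R (u + A u) = u
  mem_domain : ∀ f, R f ∈ A.domain
  apply_eq : ∀ f, A ⟨R f, mem_domain f⟩ = f - R f

/-- The function `x ↦ x⁻¹ - 1`, which recovers `A` from `(1 + A)⁻¹`. -/
def invSubOne {S : Set ℝ} (x : S) : ℝ := (x : ℝ)⁻¹ - 1

theorem measurable_invSubOne {S : Set ℝ} : Measurable (invSubOne (S := S)) :=
  measurable_subtype_coe.inv.sub_const 1

/-- The coordinate function on the spectrum. -/
def spectrumCoord (R : H →L[ℂ] H) : C(spectrum ℝ R, ℝ) := ⟨fun x => x, continuous_subtype_val⟩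

@[simp] theorem spectrumCoord_apply (R : H →L[ℂ] H) (x : spectrum ℝ R) :
    spectrumCoord R x = x := rfl

theorem cfcHom_spectrumCoord {R : H →L[ℂ] H} (hR : IsSelfAdjoint R) :
    cfcHom hR (spectrumCoord R) = R :=
  cfcHom_id hR

variable {A : H →ₗ.[ℂ] H} {R : H →L[ℂ] H} (hA : IsSelfAdjointResolvent A R)

include hA

theorem IsSelfAdjointResolvent.eq_zero {f : H} (hf : R f = 0) : f = 0 := by
  have h := hA.apply_eq f
  have h0 : (⟨R f, hA.mem_domain f⟩ : A.domain) = 0 := Subtype.ext hf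
  rw [h0, LinearPMap.map_zero, hf, sub_zero] at h
  exact h.symm

/-- `0` may belong to the spectrum of `R`, and `invSubOne` has the meaningless value `-1` there. The
point is null because `R` annihilates `1_{0}(R) u` and is injective. -/
theorem IsSelfAdjointResolvent.ae_ne_zero (u : H) :
    ∀ᵐ x : spectrum ℝ R ∂(spectralMeasure hA.isSelfAdjoint u), (x : ℝ) ≠ 0 := by
  have hS : MeasurableSet {x : spectrum ℝ R | (x : ℝ) = 0} :=
    measurable_subtype_coe (measurableSet_singleton 0)
  have h1 : R (spectralCut hA.isSelfAdjoint hS u) = 0 := by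
    have h2 := cfcHom_spectralMap hA.isSelfAdjoint u (spectrumCoord R)
      (indicatorConstLp 2 hS (measure_ne_top _ _) (1 : ℝ)) 0 (by
        filter_upwards [Lp.coeFn_zero ℝ 2 (spectralMeasure hA.isSelfAdjoint u),
          indicatorConstLp_coeFn (p := 2) (hs := hS)
            (hμs := measure_ne_top (spectralMeasure hA.isSelfAdjoint u) _) (c := (1 : ℝ))]
          with x h1 h2
        rw [h1, h2]
        by_cases hx : (x : ℝ) = 0 <;> simp [indicator, hx])
    rw [cfcHom_spectrumCoord, map_zero] at h2
    exact h2
  have h2 := norm_spectralCut_sq hA.isSelfAdjoint hS u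
  rw [hA.eq_zero h1, norm_zero, zero_pow two_ne_zero, eq_comm, measureReal_eq_zero_iff] at h2
  rw [ae_iff]
  simpa using h2

/-- The projection-valued measure of an operator with a bounded self-adjoint resolvent. -/
def IsSelfAdjointResolvent.pvm : PVM H :=
  pvmOfBounded hA.isSelfAdjoint measurable_invSubOne

theorem IsSelfAdjointResolvent.lintegral_pvm (u : H) {h : ℝ → ENNReal} (hh : Measurable h) :
    ∫⁻ t, h t ∂(hA.pvm.scalarMeasure u)
      = ∫⁻ x, h (invSubOne x) ∂(spectralMeasure hA.isSelfAdjoint u) := by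
  rw [pvm, scalarMeasure_pvmOfBounded, lintegral_map hh measurable_invSubOne]

/-- With `f = u + A u` one has `u = R f` and `A u = (1 - R) f`, so the two measures have densities
`x²` and `(1 - x)²` with respect to `ν_f`, and `(1 - x)² = (1/x - 1)² x²` off `0`. -/
theorem IsSelfAdjointResolvent.lintegral_scalarMeasure_apply (u : A.domain) {h : ℝ → ENNReal}
    (hh : Measurable h) :
    ∫⁻ t, h t ∂(hA.pvm.scalarMeasure (A u))
      = ∫⁻ t, ENNReal.ofReal (t ^ 2) * h t ∂(hA.pvm.scalarMeasure u) := by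
  have hg : Measurable (invSubOne (S := spectrum ℝ R)) := measurable_invSubOne
  rw [hA.lintegral_pvm _ hh, hA.lintegral_pvm _ (by fun_prop)]
  set f : H := u + A u with hf
  have hu : (u : H) = cfcHom hA.isSelfAdjoint (spectrumCoord R) f := by
    rw [cfcHom_spectrumCoord, hf, hA.left_inv]
  have hAu : A u = cfcHom hA.isSelfAdjoint (1 - spectrumCoord R) f := by
    rw [map_sub, sub_apply, cfcHom_one_apply, ← hu, hf]
    abel
  rw [hAu, spectralMeasure_cfcHom, hu, spectralMeasure_cfcHom,
    lintegral_withDensity_eq_lintegral_mul _ (by fun_prop) (by fun_prop),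
    lintegral_withDensity_eq_lintegral_mul _ (by fun_prop) (by fun_prop)]
  refine lintegral_congr_ae ?_
  filter_upwards [hA.ae_ne_zero f] with x hx
  simp only [Pi.mul_apply, ← mul_assoc]
  rw [← ENNReal.ofReal_mul (sq_nonneg _), ← mul_pow]
  congr 3
  simp only [ContinuousMap.sub_apply, ContinuousMap.one_apply, spectrumCoord_apply, invSubOne]
  field_simp

theorem IsSelfAdjointResolvent.scalarMeasure_univ (u : H) :
    hA.pvm.scalarMeasure u univ = ENNReal.ofReal (‖u‖ ^ 2) := by
  rw [pvm, scalarMeasure_pvmOfBounded, Measure.map_apply measurable_invSubOne MeasurableSet.univ,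
    preimage_univ, spectralMeasure_univ]

/-- Finiteness puts `1/x` into `L²(ν_u)`; the corresponding vector `w` satisfies `R w = u`, and the
range of `R` lies in the domain. -/
theorem IsSelfAdjointResolvent.mem_domain_of_lintegral {u : H}
    (hu : ∫⁻ t, ENNReal.ofReal (t ^ 2) ∂(hA.pvm.scalarMeasure u) < ⊤) : u ∈ A.domain := by
  set ν := spectralMeasure hA.isSelfAdjoint u
  rw [hA.lintegral_pvm _ (by fun_prop)] at hu
  have h1 : MemLp (invSubOne (S := spectrum ℝ R)) 2 ν := by
    refine ⟨measurable_invSubOne.aestronglyMeasurable, ?_⟩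
    rw [eLpNorm_lt_top_iff_lintegral_rpow_enorm_lt_top (by simp) (by simp)]
    refine lt_of_eq_of_lt (lintegral_congr fun x => ?_) hu
    rw [← Real.enorm_of_nonneg (sq_nonneg _), enorm_pow]
    simp
  have h2 : MemLp (fun x : spectrum ℝ R => (x : ℝ)⁻¹) 2 ν := by
    have h3 := h1.add (memLp_const (1 : ℝ))
    refine h3.ae_eq (ae_of_all _ fun x => ?_)
    simp [invSubOne]
  have h3 := cfcHom_spectralMap hA.isSelfAdjoint u (spectrumCoord R) h2.toLp
    (ContinuousMap.toLp (E := ℝ) 2 ν ℝ 1) (by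
      filter_upwards [ContinuousMap.coeFn_toLp (p := 2) (𝕜 := ℝ) ν (1 : C(spectrum ℝ R, ℝ)),
        h2.coeFn_toLp, hA.ae_ne_zero u] with x h4 h5 h6
      rw [h4, h5]
      simp [h6])
  rw [cfcHom_spectrumCoord, spectralMap_toLp, cfcHom_one_apply] at h3
  rw [← h3]
  exact hA.mem_domain _

theorem IsSelfAdjointResolvent.isSpectralResolution : hA.pvm.IsSpectralResolution A := by
  refine ⟨fun u => ⟨fun hu => ?_, hA.mem_domain_of_lintegral⟩, fun u => ?_⟩
  · have h := hA.lintegral_scalarMeasure_apply ⟨u, hu⟩ (h := fun _ => 1) measurable_const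
    simp only [lintegral_one, mul_one, hA.scalarMeasure_univ] at h
    rw [← h]
    exact ENNReal.ofReal_lt_top
  · set f : H := u + A u with hf
    have hu : (u : H) = cfcHom hA.isSelfAdjoint (spectrumCoord R) f := by
      rw [cfcHom_spectrumCoord, hf, hA.left_inv]
    have hAu : A u = cfcHom hA.isSelfAdjoint (1 - spectrumCoord R) f := by
      rw [map_sub, sub_apply, cfcHom_one_apply, ← hu, hf]
      abel
    rw [hAu, pvm, scalarMeasure_pvmOfBounded, integral_map measurable_invSubOne.aemeasurable
      (by fun_prop), hu, spectralMeasure_cfcHom, inner_cfcHom_left, ← cfcHom_mul_apply,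
      inner_cfcHom_eq_integral]
    congr 1
    change _ = ∫ x, _ ∂((spectralMeasure hA.isSelfAdjoint f).withDensity
      fun x => ((Real.toNNReal (spectrumCoord R x ^ 2) : NNReal) : ENNReal))
    rw [integral_withDensity_eq_integral_smul (by fun_prop)]
    refine integral_congr_ae (ae_of_all _ fun x => ?_)
    simp only [NNReal.smul_def, Real.coe_toNNReal _ (sq_nonneg _), smul_eq_mul,
      ContinuousMap.mul_apply, ContinuousMap.sub_apply, ContinuousMap.one_apply,
      spectrumCoord_apply, invSubOne]
    -- No null-set argument is needed here: at `0` the density `x²` cancels the meaningless value,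
    -- and `x (1 - x)` vanishes too.
    by_cases hx : (x : ℝ) = 0
    · simp [hx]
    · field_simp

/-- If `v 0, v 1, …` is the orbit `u, A u, A² u, …`, then `∫ t^{2k} d(E_t u, u) = ‖A^k u‖²`. -/
theorem IsSelfAdjointResolvent.lintegral_pow {v : ℕ → H}
    (hv : ∀ k, ∃ h : v k ∈ A.domain, A ⟨v k, h⟩ = v (k + 1)) (k : ℕ) :
    ∫⁻ t, ENNReal.ofReal ((t ^ 2) ^ k) ∂(hA.pvm.scalarMeasure (v 0))
      = ENNReal.ofReal (‖v k‖ ^ 2) := by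
  -- An arbitrary weight is needed for the induction: each application of `A` produces a factor
  -- `t²`, which is absorbed into it.
  have key : ∀ (h : ℝ → ENNReal), Measurable h →
      ∫⁻ t, h t ∂(hA.pvm.scalarMeasure (v k))
        = ∫⁻ t, ENNReal.ofReal ((t ^ 2) ^ k) * h t ∂(hA.pvm.scalarMeasure (v 0)) := by
    induction k with
    | zero => simp
    | succ k ih =>
      intro h hh
      obtain ⟨hk, hk'⟩ := hv k
      rw [← hk', hA.lintegral_scalarMeasure_apply ⟨v k, hk⟩ hh, ih _ (by fun_prop)]
      refine lintegral_congr fun t => ?_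
      rw [← mul_assoc, ← ENNReal.ofReal_mul (by positivity), pow_succ (t ^ 2)]
  have h := key (fun _ => 1) measurable_const
  simp only [lintegral_one, mul_one, hA.scalarMeasure_univ] at h
  exact h.symm

end Resolvent

/-! ### Existence of the resolvent, and domains of closures -/

section SelfAdjoint

variable {H : Type*} [NormedAddCommGroup H] [InnerProductSpace ℂ H] [CompleteSpace H]

/-- Cauchy–Schwarz applied to `‖u‖² ≤ Re ⟨u + A u, u⟩`. This coercivity gives the closed range and
injectivity of `1 + A` and the bound on its inverse. -/
theorem norm_le_norm_add_apply {A : H →ₗ.[ℂ] H} (hpos : IsNonnegative A) (u : A.domain) :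
    ‖(u : H)‖ ≤ ‖(u : H) + A u‖ := by
  have h1 : ‖(u : H)‖ ^ 2 ≤ (inner ℂ ((u : H) + A u) (u : H)).re := by
    rw [inner_add_left, Complex.add_re, ← inner_self_eq_norm_sq (𝕜 := ℂ)]
    exact le_add_of_nonneg_right (hpos u)
  have h2 : (inner ℂ ((u : H) + A u) (u : H)).re ≤ ‖(u : H) + A u‖ * ‖(u : H)‖ :=
    (Complex.re_le_norm _).trans (norm_inner_le_norm _ _)
  rcases (norm_nonneg (u : H)).eq_or_lt with h0 | h0
  · rw [← h0]; positivity
  · refine le_of_mul_le_mul_right ?_ h0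
    rw [← sq]
    exact h1.trans h2

/-- The operator `1 + A` on the domain of `A`. -/
def oneAdd (A : H →ₗ.[ℂ] H) : A.domain →ₗ[ℂ] H := A.domain.subtype + A.toFun

theorem oneAdd_apply (A : H →ₗ.[ℂ] H) (u : A.domain) : oneAdd A u = u + A u := rfl

theorem isClosed_range_oneAdd {A : H →ₗ.[ℂ] H} (hA : IsSelfAdjoint A) (hpos : IsNonnegative A) :
    IsClosed ((LinearMap.range (oneAdd A) : Submodule ℂ H) : Set H) := by
  refine IsSeqClosed.isClosed fun x a hx ha => ?_
  choose u hu using hx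
  have hcu : CauchySeq fun n => (u n : H) := by
    have hcx := ha.cauchySeq
    rw [Metric.cauchySeq_iff'] at hcx ⊢
    intro ε hε
    obtain ⟨N, hN⟩ := hcx ε hε
    refine ⟨N, fun n hn => lt_of_le_of_lt ?_ (hN n hn)⟩
    rw [dist_eq_norm, dist_eq_norm, ← hu, ← hu, ← map_sub]
    exact norm_le_norm_add_apply hpos (u n - u N)
  obtain ⟨w, hw⟩ := cauchySeq_tendsto_of_complete hcu
  have hAu : Tendsto (fun n => A (u n)) atTop (𝓝 (a - w)) := by
    refine (ha.sub hw).congr fun n => ?_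
    rw [← hu, oneAdd_apply]
    abel
  have hgraph : (w, a - w) ∈ A.graph :=
    hA.isClosed.mem_of_tendsto (hw.prodMk_nhds hAu)
      (Eventually.of_forall fun n => A.mem_graph (u n))
  obtain ⟨z, hz, hz'⟩ := (LinearPMap.mem_graph_iff A).1 hgraph
  refine ⟨z, ?_⟩
  rw [oneAdd_apply, hz', hz]
  exact add_sub_cancel w a

/-- A vector `v` orthogonal to the closed range satisfies `A* v = -v`, hence `A v = -v` by
self-adjointness, and nonnegativity then gives `v = 0`. -/
theorem range_oneAdd {A : H →ₗ.[ℂ] H} (hA : IsSelfAdjoint A) (hpos : IsNonnegative A) :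
    LinearMap.range (oneAdd A) = ⊤ := by
  have hdense := hA.dense_domain
  have hcl := isClosed_range_oneAdd hA hpos
  have : CompleteSpace (LinearMap.range (oneAdd A)) := hcl.completeSpace_coe
  rw [← Submodule.orthogonal_eq_bot_iff, Submodule.eq_bot_iff]
  intro v hv
  have h1 : ∀ x : A.domain, inner ℂ (-v) (x : H) = inner ℂ v (A x) := by
    intro x
    have h2 := (Submodule.mem_orthogonal' _ _).1 hv _ ⟨x, rfl⟩
    rw [oneAdd_apply, inner_add_right] at h2
    rw [inner_neg_left]
    linear_combination -h2
  have hv' : v ∈ (LinearPMap.adjoint A).domain :=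
    LinearPMap.mem_adjoint_domain_of_exists v ⟨-v, h1⟩
  have hAv := LinearPMap.adjoint_apply_eq hdense ⟨v, hv'⟩ h1
  have hsa : LinearPMap.adjoint A = A := LinearPMap.isSelfAdjoint_def.1 hA
  have hmem : (v, -v) ∈ A.graph := by
    rw [← hsa, ← hAv]
    exact (LinearPMap.adjoint A).mem_graph ⟨v, hv'⟩
  obtain ⟨z, hz, hz'⟩ := (LinearPMap.mem_graph_iff A).1 hmem
  have h3 := hpos z
  rw [hz', hz, inner_neg_left, Complex.neg_re] at h3
  have h4 : (inner ℂ v v).re = ‖v‖ ^ 2 := inner_self_eq_norm_sq (𝕜 := ℂ) v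
  rw [h4] at h3
  have h5 : ‖v‖ ^ 2 = 0 := le_antisymm (by linarith) (sq_nonneg _)
  simpa using h5

theorem exists_isSelfAdjointResolvent {A : H →ₗ.[ℂ] H} (hA : IsSelfAdjoint A)
    (hpos : IsNonnegative A) : ∃ R : H →L[ℂ] H, IsSelfAdjointResolvent A R := by
  have hinj : Function.Injective (oneAdd A) := by
    rw [← LinearMap.ker_eq_bot, LinearMap.ker_eq_bot']
    intro u hu
    have h := norm_le_norm_add_apply hpos u
    rw [← oneAdd_apply, hu, norm_zero] at h
    exact Subtype.ext (norm_le_zero_iff.1 h)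
  let e : A.domain ≃ₗ[ℂ] H :=
    LinearEquiv.ofBijective (oneAdd A) ⟨hinj, LinearMap.range_eq_top.1 (range_oneAdd hA hpos)⟩
  have he : ∀ f, ((e.symm f : A.domain) : H) + A (e.symm f) = f := fun f =>
    e.apply_symm_apply f
  let R : H →L[ℂ] H := LinearMap.mkContinuous (A.domain.subtype ∘ₗ e.symm.toLinearMap) 1
    (fun f => by
      have h := norm_le_norm_add_apply hpos (e.symm f)
      rw [he] at h
      rw [one_mul]
      exact h)
  have hRf : ∀ f, R f = (e.symm f : A.domain) := fun f => rfl
  have hsymm : ∀ x y : A.domain, inner ℂ (A x) (y : H) = inner ℂ (x : H) (A y) := by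
    intro x y
    have h := LinearPMap.adjoint_isFormalAdjoint hA.dense_domain (T := A)
    rw [LinearPMap.isSelfAdjoint_def.1 hA] at h
    exact h x y
  refine ⟨R, ContinuousLinearMap.isSelfAdjoint_iff_isSymmetric.2 fun f g => ?_, fun u => ?_,
    fun f => (e.symm f).2, fun f => ?_⟩
  · change inner ℂ ((e.symm f : A.domain) : H) g = inner ℂ f ((e.symm g : A.domain) : H)
    conv_lhs => rw [← he g]
    conv_rhs => rw [← he f]
    rw [inner_add_left, inner_add_right, hsymm]
  · exact congrArg Subtype.val (e.symm_apply_apply u)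
  · exact eq_sub_of_add_eq' (he f)

/-- Closability need not be assumed: by convention the closure of a non-closable operator is the
operator itself. -/
theorem mem_closure_graph_closure (T : H →ₗ.[ℂ] H) (u : T.closure.domain) :
    ((u : H), T.closure u) ∈ closure (T.graph : Set (H × H)) := by
  by_cases h : T.IsClosable
  · have h1 := T.closure.mem_graph u
    rw [← h.graph_closure_eq_closure_graph] at h1
    exact h1
  · have h1 := T.closure.mem_graph u
    have h2 : T.closure.graph = T.graph := by rw [LinearPMap.closure_def' h]
    rw [h2] at h1
    exact subset_closure h1

theorem IsNonnegative.closure {T : H →ₗ.[ℂ] H} (hT : IsNonnegative T) :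
    IsNonnegative T.closure := by
  intro u
  have hcl : IsClosed {p : H × H | 0 ≤ (inner ℂ p.2 p.1).re} :=
    isClosed_le continuous_const (Complex.continuous_re.comp (continuous_snd.inner continuous_fst))
  refine closure_minimal (s := (T.graph : Set (H × H))) ?_ hcl (mem_closure_graph_closure T u)
  intro p hp
  obtain ⟨z, hz, hz'⟩ := (LinearPMap.mem_graph_iff T).1 hp
  change 0 ≤ (inner ℂ p.2 p.1).re
  rw [← hz, ← hz']
  exact hT z

/-- For an essentially self-adjoint `T`, the weak identity `⟨w, x⟩ = ⟨u, T x⟩` puts `u` into the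
domain of the closure, with value `w`. -/
theorem IsEssentiallySelfAdjoint.closure_apply_eq {T : H →ₗ.[ℂ] H}
    (hT : IsEssentiallySelfAdjoint T) {u w : H}
    (h : ∀ x : T.domain, inner ℂ w (x : H) = inner ℂ u (T x)) :
    ∃ hu : u ∈ T.closure.domain, T.closure ⟨u, hu⟩ = w := by
  have h1 : ∀ x : T.closure.domain, inner ℂ w (x : H) = inner ℂ u (T.closure x) := by
    intro x
    have hcl : IsClosed {p : H × H | inner ℂ w p.1 = inner ℂ u p.2} :=
      isClosed_eq (continuous_const.inner continuous_fst) (continuous_const.inner continuous_snd)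
    refine closure_minimal (s := (T.graph : Set (H × H))) ?_ hcl (mem_closure_graph_closure T x)
    intro p hp
    obtain ⟨z, hz, hz'⟩ := (LinearPMap.mem_graph_iff T).1 hp
    change inner ℂ w p.1 = inner ℂ u p.2
    rw [← hz, ← hz']
    exact h z
  have hu : u ∈ (LinearPMap.adjoint T.closure).domain :=
    LinearPMap.mem_adjoint_domain_of_exists u ⟨w, h1⟩
  have hval := LinearPMap.adjoint_apply_eq hT.2.dense_domain ⟨u, hu⟩ h1
  have hmem : (u, w) ∈ T.closure.graph := by
    have h2 : (u, w) ∈ (LinearPMap.adjoint T.closure).graph := by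
      rw [← hval]
      exact (LinearPMap.adjoint T.closure).mem_graph ⟨u, hu⟩
    rwa [LinearPMap.isSelfAdjoint_def.1 hT.2] at h2
  obtain ⟨⟨z, hzd⟩, hz, hz'⟩ := (LinearPMap.mem_graph_iff _).1 hmem
  obtain rfl : z = u := hz
  exact ⟨hzd, hz'⟩

end SelfAdjoint

/-! ### Exponential integrability from factorial moment bounds -/

/-- Otherwise `y^{2k}/(2k)! < 4^{-k} e^y / 4` for every `k`, and summation gives `cosh y ≤ e^y / 3`,
contradicting `cosh y > e^y / 2`. A single dominating term, unlike the series, can be raised to the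
power `2s` directly; even terms suffice and match the available moments. -/
theorem exists_exp_le_four_mul (y : ℝ) :
    ∃ k : ℕ, Real.exp y ≤ 4 * ((2 * y) ^ (2 * k) / ((2 * k).factorial : ℝ)) := by
  by_contra! h
  have h1 := Real.hasSum_cosh y
  have h2 : HasSum (fun k : ℕ => Real.exp y / 4 * (1 / 4 : ℝ) ^ k) (Real.exp y / 4 * (4 / 3)) := by
    rw [show (4 / 3 : ℝ) = (1 - 1 / 4)⁻¹ by norm_num]
    exact (hasSum_geometric_of_lt_one (by norm_num) (by norm_num)).mul_left _
  have h3 : Real.cosh y ≤ Real.exp y / 4 * (4 / 3) := by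
    refine hasSum_le (fun k => ?_) h1 h2
    have h4 : y ^ (2 * k) / ((2 * k).factorial : ℝ)
        = (2 * y) ^ (2 * k) / ((2 * k).factorial : ℝ) * (1 / 4 : ℝ) ^ k := by
      rw [mul_pow, pow_mul 2 2 k, one_div, inv_pow]
      norm_num
      field_simp
    rw [h4]
    refine mul_le_mul_of_nonneg_right ?_ (by positivity)
    linarith [h k]
  rw [Real.cosh_eq] at h3
  linarith [Real.exp_pos y, Real.exp_pos (-y)]

theorem exists_lintegral_exp_rpow_lt_top {m : Measure ℝ} {s B c : ℝ} (hs : 1 ≤ s) (hB : 0 < B)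
    (hc : 0 ≤ c)
    (hm : ∀ k : ℕ, ∫⁻ t, ENNReal.ofReal ((t ^ 2) ^ k) ∂m
      ≤ ENNReal.ofReal (c * B ^ (2 * k) * ((2 * k).factorial : ℝ) ^ (2 * s))) :
    ∃ D : ℝ, 0 < D ∧
      ∫⁻ t, ENNReal.ofReal (Real.exp (D * t ^ (1 / (2 * s))) ^ 2) ∂m < ⊤ := by
  have hs0 : 0 < 2 * s := by linarith
  -- Chosen so that `q B = 1/2`: the `k`-th moment then contributes at most `c (1/4)^k`. `D` is
  -- fixed by `(2D)^{2s} = q`.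
  set q : ℝ := 1 / (2 * B) with hq
  have hq0 : 0 < q := by positivity
  set D : ℝ := q ^ (1 / (2 * s)) / 2 with hD
  have hD0 : 0 < D := by positivity
  have hDq : (2 * D) ^ (2 * s) = q := by
    rw [hD, mul_div_cancel₀ _ two_ne_zero, ← Real.rpow_mul hq0.le, one_div_mul_cancel hs0.ne',
      Real.rpow_one]
  have hpt : ∀ t : ℝ, ENNReal.ofReal (Real.exp (D * t ^ (1 / (2 * s))) ^ 2)
      ≤ ENNReal.ofReal (4 ^ (2 * s)) * ∑' k : ℕ, ENNReal.ofReal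
        (q ^ (2 * k) * (((2 * k).factorial : ℝ) ^ (2 * s))⁻¹) * ENNReal.ofReal ((t ^ 2) ^ k) := by
    intro t
    set y : ℝ := |t| ^ (1 / (2 * s)) with hy
    have hy0 : 0 ≤ y := by positivity
    have hyt : y ^ (2 * s) = |t| := by
      rw [hy, ← Real.rpow_mul (abs_nonneg t), one_div_mul_cancel hs0.ne', Real.rpow_one]
    obtain ⟨k, hk⟩ := exists_exp_le_four_mul (D * y)
    have h1 : Real.exp (D * t ^ (1 / (2 * s))) ^ 2 ≤ Real.exp (D * y) ^ (2 * s) := by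
      calc Real.exp (D * t ^ (1 / (2 * s))) ^ 2 ≤ Real.exp (D * y) ^ 2 := by
            gcongr
            -- Covers negative `t` as well, so the support of the measure need not be located.
            exact (le_abs_self _).trans (Real.abs_rpow_le_abs_rpow t _)
        _ = Real.exp (D * y) ^ (2 : ℝ) := (Real.rpow_two _).symm
        _ ≤ Real.exp (D * y) ^ (2 * s) :=
            Real.rpow_le_rpow_of_exponent_le (Real.one_le_exp (by positivity)) (by linarith)
    have h2 : Real.exp (D * y) ^ (2 * s) ≤ 4 ^ (2 * s) *
        (q ^ (2 * k) * (((2 * k).factorial : ℝ) ^ (2 * s))⁻¹ * (t ^ 2) ^ k) := by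
      refine (Real.rpow_le_rpow (Real.exp_pos _).le hk hs0.le).trans_eq ?_
      rw [Real.mul_rpow (by norm_num) (by positivity),
        Real.div_rpow (by positivity) (by positivity), ← mul_assoc 2 D y, mul_pow,
        Real.mul_rpow (by positivity) (by positivity), ← Real.rpow_pow_comm (by positivity),
        ← Real.rpow_pow_comm hy0, hDq, hyt, pow_mul |t|, sq_abs]
      ring
    calc ENNReal.ofReal (Real.exp (D * t ^ (1 / (2 * s))) ^ 2)
        ≤ ENNReal.ofReal (4 ^ (2 * s) *
          (q ^ (2 * k) * (((2 * k).factorial : ℝ) ^ (2 * s))⁻¹ * (t ^ 2) ^ k)) :=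
          ENNReal.ofReal_le_ofReal (h1.trans h2)
      _ = ENNReal.ofReal (4 ^ (2 * s)) * (ENNReal.ofReal
          (q ^ (2 * k) * (((2 * k).factorial : ℝ) ^ (2 * s))⁻¹) * ENNReal.ofReal ((t ^ 2) ^ k)) := by
          rw [ENNReal.ofReal_mul (by positivity), ENNReal.ofReal_mul (by positivity)]
      _ ≤ _ := by
          -- The dominating index `k` depends on `t`; bounding its term by the whole series removes
          -- this dependence.
          gcongr
          exact ENNReal.le_tsum (f := fun k : ℕ => ENNReal.ofReal
            (q ^ (2 * k) * (((2 * k).factorial : ℝ) ^ (2 * s))⁻¹) * ENNReal.ofReal ((t ^ 2) ^ k)) k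
  refine ⟨D, hD0, (lintegral_mono hpt).trans_lt ?_⟩
  rw [lintegral_const_mul _ (by fun_prop), lintegral_tsum fun k => by fun_prop]
  refine ENNReal.mul_lt_top ENNReal.ofReal_lt_top ?_
  have hterm : ∀ k : ℕ, ∫⁻ t, ENNReal.ofReal (q ^ (2 * k) * (((2 * k).factorial : ℝ) ^ (2 * s))⁻¹)
      * ENNReal.ofReal ((t ^ 2) ^ k) ∂m ≤ ENNReal.ofReal (c * (1 / 4 : ℝ) ^ k) := by
    intro k
    rw [lintegral_const_mul _ (by fun_prop)]
    refine (mul_le_mul_right (hm k) _).trans_eq ?_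
    rw [← ENNReal.ofReal_mul (by positivity)]
    congr 1
    have hf : ((2 * k).factorial : ℝ) ^ (2 * s) ≠ 0 := by positivity
    have hqB : (q * B) ^ (2 * k) = (1 / 4 : ℝ) ^ k := by
      have : q * B = 1 / 2 := by rw [hq]; field_simp
      rw [this, pow_mul]
      norm_num
    rw [← hqB, mul_pow]
    field_simp
  refine (ENNReal.tsum_le_tsum hterm).trans_lt ?_
  rw [← ENNReal.ofReal_tsum_of_nonneg (fun k => by positivity)
    ((summable_geometric_of_lt_one (by norm_num) (by norm_num)).mul_left c)]
  exact ENNReal.ofReal_lt_top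

/-! ### The closure of the sub-Laplacian on smooth square-integrable functions -/

section SubLaplacian

variable {n r : ℕ} {M : Type*} [TopologicalSpace M] [ChartedSpace (EuclideanSpace ℝ (Fin n)) M]

theorem lieD_eventuallyEq {V : (x : M) → TangentSpace (𝓡 n) x} {f g : M → ℂ} {x : M}
    (h : f =ᶠ[𝓝 x] g) : lieD V f =ᶠ[𝓝 x] lieD V g := by
  filter_upwards [eventually_eventually_nhds.2 h] with y hy
  have h1 : mfderiv (𝓡 n) 𝓘(ℝ, ℂ) f y = mfderiv (𝓡 n) 𝓘(ℝ, ℂ) g y :=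
    Filter.EventuallyEq.mfderiv_eq hy
  change mfderiv (𝓡 n) 𝓘(ℝ, ℂ) f y (V y) = mfderiv (𝓡 n) 𝓘(ℝ, ℂ) g y (V y)
  exact DFunLike.congr_fun h1 (V y)

variable [IsManifold (𝓡 n) ∞ M] (X : HormanderSystem n r M)

theorem isSmooth_zero : IsSmooth n (0 : M → ℂ) := contMDiff_const

theorem IsSmooth.const_smul (c : ℂ) {f : M → ℂ} (hf : IsSmooth n f) : IsSmooth n (c • f) :=
  ((c • ContinuousLinearMap.id ℝ ℂ : ℂ →L[ℝ] ℂ).contDiff.contMDiff).comp hf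

theorem IsSmooth.sum {ι : Type*} (t : Finset ι) {f : ι → M → ℂ} (hf : ∀ i, IsSmooth n (f i)) :
    IsSmooth n (∑ i ∈ t, f i) := by
  classical
  induction t using Finset.induction_on with
  | empty => exact isSmooth_zero
  | insert a t ha ih =>
    rw [Finset.sum_insert ha]
    exact ContMDiff.add (hf a) ih

theorem IsSmooth.wordD (w : List (Fin r)) {f : M → ℂ} (hf : IsSmooth n f) :
    IsSmooth n (wordD X w f) := by
  induction w with
  | nil => exact hf
  | cons j w ih => exact ih.lieD (X.smooth j)

theorem lap_eq_sum (f : M → ℂ) :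
    lap X f = ∑ j, (-1 : ℂ) • lieD (X.field j) (lieD (X.field j) f) := by
  funext x
  simp [lap, Finset.sum_apply]

theorem IsSmooth.lap {f : M → ℂ} (hf : IsSmooth n f) : IsSmooth n (lap X f) := by
  rw [lap_eq_sum]
  exact IsSmooth.sum _ fun j =>
    ((hf.lieD (X.smooth j)).lieD (X.smooth j)).const_smul _

theorem wordD_add (w : List (Fin r)) {f g : M → ℂ} (hf : IsSmooth n f) (hg : IsSmooth n g) :
    wordD X w (f + g) = wordD X w f + wordD X w g := by
  induction w with
  | nil => rfl
  | cons j w ih => rw [wordD, ih, lieD_add (hf.wordD X w) (hg.wordD X w)]; rfl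

theorem wordD_smul (w : List (Fin r)) (c : ℂ) {f : M → ℂ} (hf : IsSmooth n f) :
    wordD X w (c • f) = c • wordD X w f := by
  induction w with
  | nil => rfl
  | cons j w ih => rw [wordD, ih, lieD_smul c (hf.wordD X w)]; rfl

theorem wordD_sum (w : List (Fin r)) {ι : Type*} (t : Finset ι) {f : ι → M → ℂ}
    (hf : ∀ i, IsSmooth n (f i)) : wordD X w (∑ i ∈ t, f i) = ∑ i ∈ t, wordD X w (f i) := by
  classical
  induction t using Finset.induction_on with
  | empty => simpa using wordD_smul X w 0 (isSmooth_zero (n := n) (M := M))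
  | insert a t ha ih =>
    rw [Finset.sum_insert ha, Finset.sum_insert ha, wordD_add X w (hf a) (IsSmooth.sum _ hf), ih]

theorem wordD_append (v w : List (Fin r)) (f : M → ℂ) :
    wordD X (v ++ w) f = wordD X v (wordD X w f) := by
  induction v with
  | nil => rfl
  | cons j v ih => rw [List.cons_append, wordD, ih]; rfl

theorem wordD_lap (w : List (Fin r)) {f : M → ℂ} (hf : IsSmooth n f) :
    wordD X w (lap X f) = ∑ j, (-1 : ℂ) • wordD X (w ++ [j, j]) f := by
  have h2 : ∀ j, IsSmooth n (lieD (X.field j) (lieD (X.field j) f)) := fun j =>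
    (hf.lieD (X.smooth j)).lieD (X.smooth j)
  rw [lap_eq_sum, wordD_sum X w _ fun j => (h2 j).const_smul _]
  refine Finset.sum_congr rfl fun j _ => ?_
  rw [wordD_smul X w _ (h2 j), wordD_append]
  rfl

theorem isSmooth_iterate_lap {f : M → ℂ} (hf : IsSmooth n f) (k : ℕ) :
    IsSmooth n ((lap X)^[k] f) := by
  induction k with
  | zero => exact hf
  | succ k ih =>
    rw [Function.iterate_succ_apply']
    exact ih.lap X

theorem lap_eventuallyEq {f g : M → ℂ} {x : M} (h : f =ᶠ[𝓝 x] g) :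
    lap X f =ᶠ[𝓝 x] lap X g := by
  have h2 : ∀ j, lieD (X.field j) (lieD (X.field j) f)
      =ᶠ[𝓝 x] lieD (X.field j) (lieD (X.field j) g) :=
    fun j => lieD_eventuallyEq (lieD_eventuallyEq h)
  filter_upwards [eventually_all.2 h2] with y hy
  simp only [lap, hy]

theorem lap_zero : lap X (0 : M → ℂ) = 0 := by
  simpa using (isSmooth_zero (n := n) (M := M)).lap_smul X 0

theorem lap_eq_zero_of_notMem_tsupport {f : M → ℂ} {x : M} (hx : x ∉ tsupport f) :
    lap X f x = 0 := by
  have h := (lap_eventuallyEq X (notMem_tsupport_iff_eventuallyEq.1 hx)).eq_of_nhds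
  rw [h, lap_zero]
  rfl

theorem hasCompactSupport_lap {f : M → ℂ} (hf : HasCompactSupport f) :
    HasCompactSupport (lap X f) :=
  hf.mono' fun _ hx => not_imp_comm.1 (lap_eq_zero_of_notMem_tsupport X) hx

/-- A smooth function agrees with a test function near a given compact set. -/
theorem exists_isSmooth_hasCompactSupport_eventuallyEq [T2Space M] [SecondCountableTopology M]
    {f : M → ℂ} (hf : IsSmooth n f) {K : Set M} (hK : IsCompact K) :
    ∃ g : M → ℂ, IsSmooth n g ∧ HasCompactSupport g ∧ ∀ x ∈ K, g =ᶠ[𝓝 x] f := by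
  have : LocallyCompactSpace M := Manifold.locallyCompact_of_finiteDimensional (𝓡 n)
  obtain ⟨K', hK', hKK'⟩ := exists_compact_superset hK
  obtain ⟨χ, h1, h0, -⟩ := exists_contMDiffMap_one_nhds_of_subset_interior (𝓡 n) (n := (⊤ : ℕ∞))
    hK.isClosed hKK'
  refine ⟨fun x => χ x • f x, ContMDiff.smul χ.contMDiff hf, ?_, fun x hx => ?_⟩
  · refine HasCompactSupport.intro hK' fun x hx => ?_
    rw [h0 x hx, zero_smul]
  · filter_upwards [eventually_nhdsSet_iff_forall.1 h1 x hx] with y hy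
    rw [hy, one_smul]

variable [MeasurableSpace M] [BorelSpace M] (μ : Measure M)

variable {X μ}

theorem LapWellDefined.eq_zero (h : LapWellDefined X μ) :
    ∀ p : Lp ℂ 2 μ × Lp ℂ 2 μ, p ∈ lapGraph X μ → p.1 = 0 → p.2 = 0 := by
  rintro ⟨p1, p2⟩ ⟨f, hf, hfc, h1, h2⟩ h0
  refine (Lp.eq_zero_iff_ae_eq_zero).2 (h2.trans (h f hf hfc ?_))
  exact h1.symm.trans ((Lp.eq_zero_iff_ae_eq_zero).1 h0)

theorem LapEssentiallySelfAdjoint.graph_eq (h : LapEssentiallySelfAdjoint X μ) :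
    (lapOp X μ).graph = lapGraph X μ :=
  Submodule.toLinearPMap_graph_eq _ h.wellDefined.eq_zero

/-- No integration by parts: `μ` need not be compatible with the fields, so symmetry on test
functions is inherited from the self-adjoint closure. -/
theorem LapEssentiallySelfAdjoint.inner_symm (h : LapEssentiallySelfAdjoint X μ)
    {p q : Lp ℂ 2 μ × Lp ℂ 2 μ} (hp : p ∈ lapGraph X μ) (hq : q ∈ lapGraph X μ) :
    inner ℂ p.2 q.1 = inner ℂ p.1 q.2 := by
  have hsa := h.essentiallySelfAdjoint.2
  have hle := LinearPMap.le_graph_of_le (lapOp X μ).le_closure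
  rw [← h.graph_eq] at hp hq
  obtain ⟨x, hx, hx'⟩ := (LinearPMap.mem_graph_iff _).1 (hle hp)
  obtain ⟨y, hy, hy'⟩ := (LinearPMap.mem_graph_iff _).1 (hle hq)
  have h1 := LinearPMap.adjoint_isFormalAdjoint hsa.dense_domain
  rw [LinearPMap.isSelfAdjoint_def.1 hsa] at h1
  rw [← hx, ← hx', ← hy, ← hy']
  exact h1 x y

theorem memLp_of_isSmooth [IsLocallyFiniteMeasure μ] {f : M → ℂ} (hf : IsSmooth n f)
    (hfc : HasCompactSupport f) : MemLp f 2 μ :=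
  hf.continuous.memLp_of_hasCompactSupport hfc

/-- If `f` is smooth and `f`, `L f` are square integrable, then `f` is in the domain of the closure
of the sub-Laplacian on test functions, which acts on it as the differential operator. -/
theorem LapEssentiallySelfAdjoint.closure_apply_toLp [T2Space M] [SecondCountableTopology M]
    [IsLocallyFiniteMeasure μ] (h : LapEssentiallySelfAdjoint X μ) {f : M → ℂ}
    (hf : IsSmooth n f) (h1 : MemLp f 2 μ) (h2 : MemLp (lap X f) 2 μ) :
    ∃ hu : h1.toLp ∈ (lapOp X μ).closure.domain,
      (lapOp X μ).closure ⟨h1.toLp, hu⟩ = h2.toLp := by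
  refine h.essentiallySelfAdjoint.closure_apply_eq fun x => ?_
  have hx : ((x : Lp ℂ 2 μ), lapOp X μ x) ∈ lapGraph X μ := by
    rw [← h.graph_eq]
    exact (lapOp X μ).mem_graph x
  obtain ⟨ψ, hψ, hψc, hx1, hx2⟩ := id hx
  -- With `g = f` near the support of `ψ`, locality of `L` gives `⟨Lf, ψ⟩ = ⟨Lg, ψ⟩ = ⟨g, Lψ⟩ = ⟨f,
  -- Lψ⟩`, the middle equality being symmetry on test functions.
  obtain ⟨g, hg, hgc, hgf⟩ := exists_isSmooth_hasCompactSupport_eventuallyEq hf hψc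
  have hg1 := memLp_of_isSmooth (μ := μ) hg hgc
  have hg2 := memLp_of_isSmooth (μ := μ) (hg.lap X) (hasCompactSupport_lap X hgc)
  have hsym := h.inner_symm (p := (hg1.toLp, hg2.toLp))
    ⟨g, hg, hgc, hg1.coeFn_toLp, hg2.coeFn_toLp⟩ hx
  have e1 : inner ℂ h2.toLp (x : Lp ℂ 2 μ) = inner ℂ hg2.toLp (x : Lp ℂ 2 μ) := by
    rw [L2.inner_def, L2.inner_def]
    refine integral_congr_ae ?_
    filter_upwards [h2.coeFn_toLp, hg2.coeFn_toLp, hx1] with y hy1 hy2 hy3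
    rw [hy1, hy2, hy3]
    by_cases hy : y ∈ tsupport ψ
    · rw [(lap_eventuallyEq X (hgf y hy)).eq_of_nhds]
    · rw [image_eq_zero_of_notMem_tsupport hy, inner_zero_right, inner_zero_right]
  have e2 : inner ℂ h1.toLp (lapOp X μ x) = inner ℂ hg1.toLp (lapOp X μ x) := by
    rw [L2.inner_def, L2.inner_def]
    refine integral_congr_ae ?_
    filter_upwards [h1.coeFn_toLp, hg1.coeFn_toLp, hx2] with y hy1 hy2 hy3
    rw [hy1, hy2, hy3]
    by_cases hy : y ∈ tsupport ψ
    · rw [(hgf y hy).eq_of_nhds]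
    · rw [lap_eq_zero_of_notMem_tsupport X hy, inner_zero_right, inner_zero_right]
  rw [e1, e2]
  exact hsym

/-- Each factor `L` replaces a word derivative by `r` of them, two letters longer. The prefix `w` is
general because the induction lengthens it. -/
theorem eLpNorm_wordD_iterate_lap_le {φ : M → ℂ} (hφ : IsSmooth n φ) {b : ℕ → ENNReal}
    (hb : ∀ w : List (Fin r), eLpNorm (wordD X w φ) 2 μ ≤ b w.length) (k : ℕ)
    (w : List (Fin r)) :
    eLpNorm (wordD X w ((lap X)^[k] φ)) 2 μ ≤ (r : ENNReal) ^ k * b (w.length + 2 * k) := by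
  induction k generalizing w with
  | zero => simpa using hb w
  | succ k ih =>
    have hs := isSmooth_iterate_lap X hφ k
    rw [Function.iterate_succ_apply', wordD_lap X w hs]
    refine (eLpNorm_sum_le (fun j _ => ?_) (by norm_num)).trans ?_
    · exact (((hs.wordD X _).const_smul _).continuous.aestronglyMeasurable)
    · refine (Finset.sum_le_card_nsmul _ _ ((r : ENNReal) ^ k * b (w.length + 2 * (k + 1)))
        fun j _ => ?_).trans_eq ?_
      · rw [eLpNorm_const_smul, enorm_neg, enorm_one, one_mul]
        refine (ih _).trans_eq ?_
        congr 2
        simp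
        ring
      · rw [Finset.card_univ, Fintype.card_fin, nsmul_eq_mul, ← mul_assoc, pow_succ']

end SubLaplacian

theorem sum_count_eq_length {r : ℕ} (w : List (Fin r)) : ∑ k, w.count k = w.length := by
  have h := Multiset.sum_count_eq_card (s := Finset.univ) (m := (w : Multiset (Fin r)))
    fun a _ => Finset.mem_univ a
  simpa using h

end SubGevrey
end
open SubGevrey

theorem theorem4p5 {n r : ℕ} {M : Type*} [TopologicalSpace M] [T2Space M]
    [SecondCountableTopology M] [ChartedSpace (EuclideanSpace ℝ (Fin n)) M]
    [IsManifold (𝓡 n) ∞ M] [MeasurableSpace M] [BorelSpace M]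
    (μ : Measure M) [IsLocallyFiniteMeasure μ]
    (X : SubGevrey.HormanderSystem n r M)
    (hSobolev : SubGevrey.SobolevEmbedding X μ)
    (hesa : SubGevrey.LapEssentiallySelfAdjoint X μ)
    (hnonneg : SubGevrey.IsNonnegative (SubGevrey.lapOp X μ))
    (s : ℝ) (hs : 1 ≤ s) :
    SubGevrey.gevreyL2 X μ s ⊆ SubGevrey.expSpace X μ s := by
  rintro φ ⟨hφ, A, C, hA, hC, hbound⟩
  have hword : ∀ w : List (Fin r), eLpNorm (wordD X w φ) 2 μ
      ≤ ENNReal.ofReal (C * A ^ w.length * (w.length.factorial : ℝ) ^ s) := by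
    intro w
    refine (hbound (fun k => w.count k) w fun k => rfl).trans (ENNReal.ofReal_le_ofReal ?_)
    rw [sum_count_eq_length]
    gcongr
    -- `α! ≤ |α|!`, since the quotient `|α|!/α!` is a multinomial coefficient.
    have h := Nat.le_of_dvd (Nat.factorial_pos _)
      (Nat.prod_factorial_dvd_factorial_sum Finset.univ fun k => w.count k)
    rwa [sum_count_eq_length] at h
  have hlap : ∀ k : ℕ, eLpNorm ((lap X)^[k] φ) 2 μ ≤ ENNReal.ofReal
      ((r : ℝ) ^ k * (C * A ^ (2 * k) * ((2 * k).factorial : ℝ) ^ s)) := by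
    intro k
    have h := eLpNorm_wordD_iterate_lap_le (X := X) (μ := μ) hφ
      (b := fun N => ENNReal.ofReal (C * A ^ N * (N.factorial : ℝ) ^ s)) hword k []
    rw [ENNReal.ofReal_mul (by positivity), ENNReal.ofReal_pow (by positivity),
      ENNReal.ofReal_natCast]
    simpa [wordD] using h
  have hsm := isSmooth_iterate_lap X hφ
  have hmem : ∀ k : ℕ, MemLp ((lap X)^[k] φ) 2 μ := fun k =>
    ⟨(hsm k).continuous.aestronglyMeasurable, (hlap k).trans_lt ENNReal.ofReal_lt_top⟩
  obtain ⟨R, hR⟩ := exists_isSelfAdjointResolvent hesa.essentiallySelfAdjoint.2 hnonneg.closure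
  have horbit : ∀ k : ℕ, ∃ h : (hmem k).toLp ∈ (lapOp X μ).closure.domain,
      (lapOp X μ).closure ⟨(hmem k).toLp, h⟩ = (hmem (k + 1)).toLp := by
    intro k
    have hk : MemLp (lap X ((lap X)^[k] φ)) 2 μ := by
      simpa only [Function.iterate_succ_apply'] using hmem (k + 1)
    obtain ⟨hu, hval⟩ := hesa.closure_apply_toLp (hsm k) (hmem k) hk
    refine ⟨hu, hval.trans ?_⟩
    simp only [Function.iterate_succ_apply']
  -- Squaring the bound on `‖L^k φ‖` gives `C² (r A²)^{2k} (2k)!^{2s}`; the added `1` keeps `B`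
  -- positive when `r = 0`.
  obtain ⟨D, hD, hexp⟩ := exists_lintegral_exp_rpow_lt_top (m := hR.pvm.scalarMeasure (hmem 0).toLp)
    (s := s) (B := r * A ^ 2 + 1) (c := C ^ 2) hs (by positivity) (by positivity) (fun k => by
      rw [hR.lintegral_pow (v := fun k => (hmem k).toLp) horbit k]
      refine ENNReal.ofReal_le_ofReal ?_
      rw [Lp.norm_toLp]
      have h1 : (eLpNorm ((lap X)^[k] φ) 2 μ).toReal
          ≤ (r : ℝ) ^ k * (C * A ^ (2 * k) * ((2 * k).factorial : ℝ) ^ s) :=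
        ENNReal.toReal_le_of_le_ofReal (by positivity) (hlap k)
      calc (eLpNorm ((lap X)^[k] φ) 2 μ).toReal ^ 2
          ≤ ((r : ℝ) ^ k * (C * A ^ (2 * k) * ((2 * k).factorial : ℝ) ^ s)) ^ 2 := by gcongr
        _ = C ^ 2 * (r * A ^ 2) ^ (2 * k) * ((2 * k).factorial : ℝ) ^ (2 * s) := by
          rw [mul_comm 2 s, Real.rpow_mul (by positivity), Real.rpow_two]
          ring
        _ ≤ _ := by
          gcongr
          linarith)
  exact ⟨hφ, D, hD, (hmem 0).toLp, (hmem 0).coeFn_toLp, hR.pvm, hR.isSpectralResolution, hexp⟩
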